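/- **Setting.** Let $I=[0,1]$. A $\Box$-set $X$ consists of sets $X_n$ ($n\ge 0$) of $n$-cubes and face maps $d_i^{\alpha}:X_n\to X_{n-1}$ ($\alpha\in\{0,1\}$, $1\le i\le n$) with $d_i^{\alpha}d_j^{\beta}=d_{j-1}^{\beta}d_i^{\alpha}$ for $i<j$. Its realization is $|X|=\bigsqcup_n X_n\times I^n/\!\sim$, where $[d_i^{\alpha}c,x]\sim[c,\delta_i^{\alpha}x]$ and $\delta_i^\alpha$ inserts $\alpha$ as $i$-th coordinate. The source and the target vertex of a cube are its iterated faces $d_1^0\cdots d_1^0c$ and $d_1^1\cdots d_1^1c$. A partition $J=[J_0|J_*|J_1]$ of $\{1,\dots,n\}$ determines the iterated face $d_Jc$ of an $n$-cube $c$, in which the coordinates in $J_0$ are fixed to be $0$ and those in $J_1$ to be $1$; the collar of the corresponding face of $I^n$ is $C_J=[0,\tfrac12)^{J_0}\times I^{J_*}\times(\tfrac12,1]^{J_1}$. The collar $C(d,X)\subset|X|$ of a cube $d$ is the union of all $[c;C_J]$ for which $d_Jc$ is an iterated face of $d$ (or $d$ itself); the star $st(v)$ of a vertex is $C(v,X)$.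 **Paths.** A path $p:I\to|X|$ is a *d-path* if it has a presentation: there are $0=t_0\le\dots\le t_l=1$, cubes $c_i$ and continuous paths $\beta_i:[t_{i-1},t_i]\to I^{\dim c_i}$ with non-decreasing coordinates such that $p(t)=[c_i;\beta_i(t)]$ on $[t_{i-1},t_i]$. It is *strict* if there is a presentation for which, moreover, every coordinate $\beta$ of every $\beta_i$ satisfies: $\beta(t)=\beta(t')$ implies $t=t'$ or $\beta(t)\in\{0,1\}$. It is *tame* if there is a presentation for which all $p(t_i)$ are vertices. A *cube chain* from $x^-$ to $x^+$ is a sequence $\mathbf c=(c_1,\dots,c_n)$, $n\ge1$, of cubes of positive dimension and vertices $x^-=x_0,x_1,\dots,x_n=x^+$ such that $c_i$ has source $x_{i-1}$ and target $x_i$. A d-path $p$ is *subordinate to $\mathbf c$* if there are $0=t_0\le\dots\le t_n=1$ such that on each $[t_{i-1},t_i]$ one has $p=[c_i;\beta_i]$ with $\beta_i$ non-decreasing from $(0,\dots,0)$ to $(1,\dots,1)$. It is *subordinate to the collar of $\mathbf c$* if there are $0=t_0\le\dots\le t_n=1$ such that $p(t_i)\in st(x_i)$ for all $i$ and, for $1\le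 i\le n$, $p$ runs on $[t_{i-1},t_i]$ in $C(c_i,X)$ from the bottom to the top corner of $c_i$, in the following sense. There are a presentation of $p|_{[t_{i-1},t_i]}$ by pieces $[u_k;\beta_k]$ and partitions $J^k$ and $K^k$ with $d_{J^k}u_k=d_{K^k}c_i$ such that $\beta_k$ stays in $C_{J^k}$. Let $r_k(t)\in I^{\dim c_i}$ be the point of the face of $I^{\dim c_i}$ given by $K^k$ whose free coordinates are the $J^k_*$-coordinates of $\beta_k(t)$. Then, at the time separating the pieces $k$ and $k+1$, each coordinate of $r_k$ and the same coordinate of $r_{k+1}$ are both $<\tfrac12$, both $=\tfrac12$ or both $>\tfrac12$; all coordinates of the first $r_k$ are $<\tfrac12$ at time $t_{i-1}$, and all coordinates of the last $r_k$ are $>\tfrac12$ at time $t_i$. Let $\vec{ST}_{\mathbf c}(X)_{x^-}^{x^+}$ be the space of strict d-paths from $x^-$ to $x^+$ subordinate to $\mathbf c$ (they are tame), and let $\vec S^C_{\mathbf c}(X)_{x^-}^{x^+}$ and $\vec{ST}^C_{\mathbf c}(X)_{x^-}^{x^+}$ be the spaces of strict, respectively of strict and tame, d-paths from $x^-$ to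 $x^+$ subordinate to the collar of $\mathbf c$; all of them are subspaces of $|X|^I$ with the compact-open topology. **Proposition.** For every $\Box$-set $X$, all vertices $x^-,x^+$ and every cube chain $\mathbf c$ in $X$ from $x^-$ to $x^+$: 1. $\vec{ST}_{\mathbf c}(X)_{x^-}^{x^+}\subseteq\vec{S}^C_{\mathbf c}(X)_{x^-}^{x^+}$ is a deformation retract; 2. $\vec{ST}_{\mathbf c}(X)_{x^-}^{x^+}\subseteq\vec{ST}^C_{\mathbf c}(X)_{x^-}^{x^+}$ is a deformation retract. Here $A\subseteq B$ is a deformation retract if there are a continuous $\rho:B\to A$ and a homotopy in $B$ from $\mathrm{id}_B$ to $\rho$ that fixes every point of $A$ at all times. -/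

import Mathlib

open Set unitInterval

universe u

noncomputable section

/-- A `□`-set (pre-cubical set). Coordinates are numbered from `0`; `face false i` and
`face true i` are the lower and the upper `i`-th face maps. -/
structure PrecubicalSet where
  cube : ℕ → Type u
  face : ∀ {n : ℕ}, Bool → Fin (n + 1) → cube (n + 1) → cube n
  face_face : ∀ {n : ℕ} (α β : Bool) (i j : Fin (n + 1)), i ≤ j → ∀ c : cube (n + 2),
    face α i (face β j.succ c) = face β j (face α i.castSucc c)

namespace PrecubicalSet

/-- The end point `0` or `1` of the unit interval. -/
def endpt (α : Bool) : I := if α then 1 else 0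

variable (X : PrecubicalSet.{u})

/-- The source (`α = false`) or the target (`α = true`) vertex of a cube. -/
def corner (α : Bool) : ∀ {n : ℕ}, X.cube n → X.cube 0
  | 0, c => c
  | _ + 1, c => corner α (X.face α 0 c)

/-- The disjoint union of one copy of `Iⁿ` for every `n`-cube. -/
abbrev Cells : Type u := (c : Σ n, X.cube n) × (Fin c.1 → I)

/-- The generating identifications `[d_i^α c, x] ∼ [c, δ_i^α x]`. -/
inductive Glue : X.Cells → X.Cells → Prop
  | glue {n : ℕ} (c : X.cube (n + 1)) (α : Bool) (i : Fin (n + 1)) (x : Fin n → I) :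
      Glue ⟨⟨n, X.face α i c⟩, x⟩ ⟨⟨n + 1, c⟩, i.insertNth (α := fun _ => I) (endpt α) x⟩

/-- The geometric realization, with the quotient topology. -/
def Realization : Type u := Quot X.Glue

instance : TopologicalSpace X.Realization :=
  inferInstanceAs (TopologicalSpace (Quot X.Glue))

variable {X}

/-- The point `[c; x]` of the realization. -/
def pt {n : ℕ} (c : X.cube n) (x : Fin n → I) : X.Realization := Quot.mk _ ⟨⟨n, c⟩, x⟩

/-- A vertex as a point of the realization. -/
def vpt (v : X.cube 0) : X.Realization := pt v Fin.elim0

/-! ### Directed paths -/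

/-- `β` restricts to a (continuous) increasing path `[a,b] → Iⁿ`. -/
def Increasing {n : ℕ} (β : I → Fin n → I) (a b : I) : Prop :=
  ContinuousOn β (Icc a b) ∧ MonotoneOn β (Icc a b)

/-- `β` restricts to a strictly increasing path `[a,b] → Iⁿ`: every coordinate may only pause
at `0` and at `1`. -/
def StrictlyIncreasing {n : ℕ} (β : I → Fin n → I) (a b : I) : Prop :=
  Increasing β a b ∧
    ∀ i, ∀ s ∈ Icc a b, ∀ s' ∈ Icc a b, β s i = β s' i → s = s' ∨ β s i = 0 ∨ β s i = 1

/-- `0 = t_0 ≤ t_1 ≤ … ≤ t_l = 1`. -/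
def IsSubdivision {l : ℕ} (t : Fin (l + 1) → I) : Prop :=
  Monotone t ∧ t 0 = 0 ∧ t (Fin.last l) = 1

/-- On `[a,b]` the path `p` is `[c; β]`. -/
def Presents {n : ℕ} (p : C(I, X.Realization)) (a b : I) (c : X.cube n) (β : I → Fin n → I) :
    Prop :=
  ∀ s ∈ Icc a b, p s = pt c (β s)

/-- `p` is a d-path. -/
def IsDPath (p : C(I, X.Realization)) : Prop :=
  ∃ (l : ℕ) (t : Fin (l + 1) → I), IsSubdivision t ∧ ∀ k : Fin l,
    ∃ (n : ℕ) (c : X.cube n) (β : I → Fin n → I),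
      Increasing β (t k.castSucc) (t k.succ) ∧ Presents p (t k.castSucc) (t k.succ) c β

/-- `p` is a strict d-path. -/
def IsStrict (p : C(I, X.Realization)) : Prop :=
  ∃ (l : ℕ) (t : Fin (l + 1) → I), IsSubdivision t ∧ ∀ k : Fin l,
    ∃ (n : ℕ) (c : X.cube n) (β : I → Fin n → I),
      StrictlyIncreasing β (t k.castSucc) (t k.succ) ∧ Presents p (t k.castSucc) (t k.succ) c β

/-- `p` is a tame d-path. -/
def IsTame (p : C(I, X.Realization)) : Prop :=
  ∃ (l : ℕ) (t : Fin (l + 1) → I), IsSubdivision t ∧ (∀ k, ∃ v : X.cube 0, p (t k) = vpt v) ∧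
    ∀ k : Fin l, ∃ (n : ℕ) (c : X.cube n) (β : I → Fin n → I),
      Increasing β (t k.castSucc) (t k.succ) ∧ Presents p (t k.castSucc) (t k.succ) c β

/-- The space of strict d-paths from `x` to `y`; as a subset of `C(I, |X|)` it carries the
compact-open topology. -/
def strictPaths (x y : X.cube 0) : Set C(I, X.Realization) :=
  {p | p 0 = vpt x ∧ p 1 = vpt y ∧ IsStrict p}

/-- The space of strict tame d-paths from `x` to `y`. -/
def strictTamePaths (x y : X.cube 0) : Set C(I, X.Realization) :=
  {p | p 0 = vpt x ∧ p 1 = vpt y ∧ IsStrict p ∧ IsTame p}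

/-! ### Iterated faces and collars -/

/-- `IsFace e c φ`: the `k`-cube `e` is the iterated face `d_{[J₀|J_*|J₁]} c` of the `n`-cube `c`.
The partition is recorded by `φ : Fin n → Bool ⊕ Fin k`: it takes the value `inl false` on `J₀`,
`inl true` on `J₁`, and it sends the `j`-th element of `J_*` to `inr j`. -/
inductive IsFace : ∀ {k n : ℕ}, X.cube k → X.cube n → (Fin n → Bool ⊕ Fin k) → Prop
  | refl {n : ℕ} (c : X.cube n) : IsFace c c Sum.inr
  | step {k n : ℕ} {e : X.cube k} (c : X.cube (n + 1)) (α : Bool) (i : Fin (n + 1))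
      (φ : Fin n → Bool ⊕ Fin k) (h : IsFace e (X.face α i c) φ) :
      IsFace e c (i.insertNth (α := fun _ => Bool ⊕ Fin k) (Sum.inl α) φ)

/-- The inclusion `I^k → I^n` of the face `{0}^{J₀} × I^{J_*} × {1}^{J₁}` given by `φ`. -/
def faceMap {k n : ℕ} (φ : Fin n → Bool ⊕ Fin k) (z : Fin k → I) : Fin n → I :=
  fun i => Sum.elim endpt z (φ i)

/-- The collar `[0,0.5[^{J₀} × I^{J_*} × ]0.5,1]^{J₁}` of the face of `Iⁿ` given by `φ`. -/
def faceCollar {k n : ℕ} (φ : Fin n → Bool ⊕ Fin k) : Set (Fin n → I) :=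
  {y | ∀ i, (φ i = Sum.inl false → (y i : ℝ) < 1 / 2) ∧ (φ i = Sum.inl true → 1 / 2 < (y i : ℝ))}

/-- The collar `C(d, X)`: the union of the collars in all cubes `c` of those faces of `c` that are
also faces of `d`. -/
def collar {m : ℕ} (d : X.cube m) : Set X.Realization :=
  {x | ∃ (n k : ℕ) (c : X.cube n) (e : X.cube k) (φ : Fin n → Bool ⊕ Fin k)
    (ψ : Fin m → Bool ⊕ Fin k), IsFace e c φ ∧ IsFace e d ψ ∧ ∃ y ∈ faceCollar φ, x = pt c y}

/-- The star of a vertex is its collar. -/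
def star (v : X.cube 0) : Set X.Realization := collar v

/-- `r` is a shadow of `p` in the cube `d` over the time interval `[a,b]`: on `[a,b]` the path has
the form `[c; β]` with `β` an increasing path in the collar of a face `e` of `c` that is identified
with a face of `d`, and `r s ∈ I^m` is the point of that face of `d` whose free coordinates are
those of `β s`. -/
def IsShadow {m : ℕ} (p : C(I, X.Realization)) (d : X.cube m) (a b : I) (r : I → Fin m → I) :
    Prop :=
  ∃ (n k : ℕ) (c : X.cube n) (e : X.cube k) (φ : Fin n → Bool ⊕ Fin k)
    (ψ : Fin m → Bool ⊕ Fin k) (β : I → Fin n → I),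
    IsFace e c φ ∧ IsFace e d ψ ∧ Increasing β a b ∧ Presents p a b c β ∧
    ∀ s ∈ Icc a b, β s ∈ faceCollar φ ∧
      ∃ z : Fin k → I, (∀ i j, φ i = Sum.inr j → β s i = z j) ∧ r s = faceMap ψ z

/-- Two points of `I^m` lie on the same side of (or both on) each middle hyperplane `x_i = 0.5`. -/
def SameSide {m : ℕ} (x y : Fin m → I) : Prop :=
  ∀ i, ((x i : ℝ) < 1 / 2 ↔ (y i : ℝ) < 1 / 2) ∧ (1 / 2 < (x i : ℝ) ↔ 1 / 2 < (y i : ℝ))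

/-- Over `[a,b]` the path `p` runs through the collar of `d` from the star of the source corner to
the star of the target corner, with respect to the coordinates of the cube `d` itself: it has a
presentation with shadows in `I^m` whose positions relative to the middle hyperplanes fit together,
lead from the star of `(0,…,0)` and to the star of `(1,…,1)`.

If distinct faces of `d` may coincide in `X`, this is more than running in `C(d, X)` from the star
of the source to that of the target; for instance, if `d` is a loop, `p` runs through `d` exactly
once. -/
def RunsThrough {m : ℕ} (p : C(I, X.Realization)) (d : X.cube m) (a b : I) : Prop :=
  ∃ (l : ℕ) (s : Fin (l + 2) → I) (r : Fin (l + 1) → I → Fin m → I),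
    Monotone s ∧ s 0 = a ∧ s (Fin.last (l + 1)) = b ∧
    (∀ k, IsShadow p d (s k.castSucc) (s k.succ) (r k)) ∧
    (∀ k : Fin l, SameSide (r k.castSucc (s k.succ.castSucc)) (r k.succ (s k.succ.castSucc))) ∧
    (∀ i, (r 0 a i : ℝ) < 1 / 2) ∧ (∀ i, 1 / 2 < (r (Fin.last l) b i : ℝ))

/-! ### Cube chains -/

variable (X) in
/-- A cube chain `(c_1, …, c_n)` from `x` to `y`, with its vertex sequence `(x_0, …, x_n)`. -/
structure CubeChain (x y : X.cube 0) where
  n : ℕ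
  n_pos : 0 < n
  dim : Fin n → ℕ
  dim_pos : ∀ i, 0 < dim i
  cube : ∀ i, X.cube (dim i)
  vertex : Fin (n + 1) → X.cube 0
  source_eq : ∀ i, X.corner false (cube i) = vertex i.castSucc
  target_eq : ∀ i, X.corner true (cube i) = vertex i.succ
  vertex_zero : vertex 0 = x
  vertex_last : vertex (Fin.last n) = y

namespace CubeChain

variable {x y : X.cube 0} (c : CubeChain X x y)

/-- The (tame) d-paths subordinate to `c`. -/
def tamePathsIn : Set C(I, X.Realization) :=
  {p | ∃ t : Fin (c.n + 1) → I, IsSubdivision t ∧ ∀ i : Fin c.n,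
    ∃ β : I → Fin (c.dim i) → I, Increasing β (t i.castSucc) (t i.succ) ∧
      Presents p (t i.castSucc) (t i.succ) (c.cube i) β ∧
      β (t i.castSucc) = 0 ∧ β (t i.succ) = 1}

/-- The d-paths subordinate to the collar of `c`. -/
def pathsInCollar : Set C(I, X.Realization) :=
  {p | IsDPath p ∧ ∃ t : Fin (c.n + 1) → I, IsSubdivision t ∧
    (∀ i, p (t i) ∈ star (c.vertex i)) ∧
    ∀ i : Fin c.n, (∀ s ∈ Icc (t i.castSucc) (t i.succ), p s ∈ collar (c.cube i)) ∧
      RunsThrough p (c.cube i) (t i.castSucc) (t i.succ)}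

/-- The strict tame d-paths from `x` to `y` subordinate to `c`. -/
def strictTameIn : Set C(I, X.Realization) := c.tamePathsIn ∩ strictPaths x y

/-- The strict d-paths from `x` to `y` subordinate to the collar of `c`. -/
def strictInCollar : Set C(I, X.Realization) := c.pathsInCollar ∩ strictPaths x y

/-- The strict tame d-paths from `x` to `y` subordinate to the collar of `c`. -/
def strictTameInCollar : Set C(I, X.Realization) := c.pathsInCollar ∩ strictTamePaths x y

end CubeChain

end PrecubicalSet

/-- `A ⊆ B` is a deformation retract of `B`: there are a map `ρ : B → A` and a homotopy from the
identity of `B` to `ρ` (followed by the inclusion) that keeps `A` pointwise fixed. -/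
def IsDeformationRetract {Y : Type*} [TopologicalSpace Y] (A B : Set Y) : Prop :=
  ∃ (hAB : A ⊆ B) (ρ : C(B, A)),
    Nonempty (ContinuousMap.HomotopyRel (ContinuousMap.id B)
      ((ContinuousMap.mk (Set.inclusion hAB) (continuous_inclusion hAB)).comp ρ)
      {b : B | (b : Y) ∈ A})

end

/-! For `a ≥ 1`, stretch every coordinate by `x ↦ 1/2 + a (x - 1/2)`, cut off at `0` and `1`. The
end points are fixed, so the stretchings descend to `|X|`, where they form a jointly continuous
action of the monoid `[1,∞)`. They are monotone, fix vertices and keep each coordinate on its side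
of `1/2`; hence they preserve d-paths, strictness, tameness and collars. A large factor cuts off the
collar coordinates, so it moves a path subordinate to the collar of `c` onto one subordinate to `c`
(`exists_stretchPath_mem_tamePathsIn`). Let `stretchFactor` be the infimum of the factors that do
this. Stretching `p` by factors from `1` to `stretchFactor p` is the deformation; it is stationary
on paths already subordinate to `c`, whose factor is `1`. Both statements follow from this one
construction, once `stretchFactor` is known to be continuous and the infimum to be attained.

Upper semicontinuity is `eventually_mem_tamePathsIn`: a d-path near a subordinate one need not be
subordinate, but any factor `μ > 1` makes it so. Near each point of a cube, a slight stretching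
pushes a neighbourhood into a single open face, where lifts to the cube are unique; these local
lifts are chained along the path by connectedness of the time interval.

Lower semicontinuity and attainment follow from `mem_tamePathsIn_of_mem_closure`: subordinate paths
are closed among the strict paths of the collar. A subordinate path lifts to a monotone path in the
product of the cubes of `c`, and pointwise limits of such lifts exist by compactness. A limit might
jump between points that `X` identifies. Strictness excludes this: the number of coordinates equal
to `1/2` is an invariant of points of `|X|` and of stretching, and is nonzero at finitely many times
only. Comparison with a stretched, continuous lift shows that each coordinate takes the value `1/2`
exactly once, which leaves no room for a jump (`continuous_of_monotone_lift`). -/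

namespace PrecubicalSet

open Filter Topology

/-! ### Stretching the unit interval away from its midpoint -/

/-- The map `x ↦ 1/2 + a (x - 1/2)`, `a ≥ 1`, cut off at the end points of `I`. -/
noncomputable def stretch (a : ℝ) (x : I) : I :=
  projIcc 0 1 zero_le_one (1 / 2 + max a 1 * ((x : ℝ) - 1 / 2))

theorem coe_stretch (a : ℝ) (x : I) :
    (stretch a x : ℝ) = max 0 (min 1 (1 / 2 + max a 1 * ((x : ℝ) - 1 / 2))) := by
  rw [stretch, coe_projIcc]

theorem continuous_stretch : Continuous fun q : ℝ × I => stretch q.1 q.2 := by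
  unfold stretch
  fun_prop

theorem continuous_stretch_right (a : ℝ) : Continuous (stretch a) :=
  continuous_stretch.comp (Continuous.prodMk_right a)

theorem stretch_monotone (a : ℝ) : Monotone (stretch a) := by
  intro x y h
  have h' : (x : ℝ) ≤ y := h
  exact monotone_projIcc _ (by gcongr)

theorem stretch_zero (a : ℝ) : stretch a 0 = 0 := by
  apply projIcc_of_le_left
  norm_num

theorem stretch_one (a : ℝ) : stretch a 1 = 1 := by
  have h1 : (1 : ℝ) ≤ max a 1 := le_max_right _ _
  apply projIcc_of_right_le
  norm_num
  linarith

theorem stretch_endpt (a : ℝ) (α : Bool) : stretch a (endpt α) = endpt α := by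
  cases α
  · exact stretch_zero a
  · exact stretch_one a

theorem stretch_one_left (x : I) : stretch 1 x = x := by
  have : (1 / 2 + max (1 : ℝ) 1 * ((x : ℝ) - 1 / 2)) = x := by rw [max_self]; ring
  rw [stretch, this, projIcc_val]

theorem stretch_eq_zero_iff {a : ℝ} {x : I} :
    stretch a x = 0 ↔ 1 / 2 + max a 1 * ((x : ℝ) - 1 / 2) ≤ 0 :=
  projIcc_eq_left zero_lt_one

theorem stretch_eq_one_iff {a : ℝ} {x : I} :
    stretch a x = 1 ↔ 1 ≤ 1 / 2 + max a 1 * ((x : ℝ) - 1 / 2) :=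
  projIcc_eq_right zero_lt_one

theorem coe_stretch_of_ne {a : ℝ} {x : I} (h0 : stretch a x ≠ 0) (h1 : stretch a x ≠ 1) :
    (stretch a x : ℝ) = 1 / 2 + max a 1 * ((x : ℝ) - 1 / 2) := by
  rw [Ne, stretch_eq_zero_iff, not_le] at h0
  rw [Ne, stretch_eq_one_iff, not_le] at h1
  rw [coe_stretch, min_eq_right h1.le, max_eq_right h0.le]

/-- Cut-off values stay at the fixed end points, and between the cuts the slopes multiply. Both
factors must be at least `1`, since smaller ones are replaced by `1`. -/
theorem stretch_stretch {a b : ℝ} (ha : 1 ≤ a) (hb : 1 ≤ b) (x : I) :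
    stretch a (stretch b x) = stretch (a * b) x := by
  have hab : 1 ≤ a * b := by nlinarith
  by_cases h0 : stretch b x = 0
  · rw [h0, stretch_zero, eq_comm, stretch_eq_zero_iff, max_eq_left hab]
    rw [stretch_eq_zero_iff, max_eq_left hb] at h0
    nlinarith
  by_cases h1 : stretch b x = 1
  · rw [h1, stretch_one, eq_comm, stretch_eq_one_iff, max_eq_left hab]
    rw [stretch_eq_one_iff, max_eq_left hb] at h1
    nlinarith
  rw [stretch, coe_stretch_of_ne h0 h1, stretch, max_eq_left hab, max_eq_left ha, max_eq_left hb]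
  ring_nf

/-- Off the cuts the map is affine with positive slope; this is why stretching preserves strictness.
-/
theorem eq_of_stretch_eq {a : ℝ} {x y : I} (h : stretch a x = stretch a y)
    (h0 : stretch a x ≠ 0) (h1 : stretch a x ≠ 1) : x = y := by
  have hx := coe_stretch_of_ne h0 h1
  rw [h] at h0 h1
  have hy := coe_stretch_of_ne h0 h1
  rw [h, hy] at hx
  have : (0 : ℝ) < max a 1 := lt_of_lt_of_le zero_lt_one (le_max_right _ _)
  have h2 := mul_left_cancel₀ this.ne' (add_left_cancel hx)
  exact Subtype.ext (by linarith)

theorem stretch_lt_half_iff (a : ℝ) (x : I) : (stretch a x : ℝ) < 1 / 2 ↔ (x : ℝ) < 1 / 2 := by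
  have : (1 : ℝ) ≤ max a 1 := le_max_right _ _
  rw [coe_stretch, max_lt_iff, min_lt_iff]
  constructor
  · rintro ⟨-, h | h⟩
    · norm_num at h
    · by_contra h'
      nlinarith
  · intro h
    exact ⟨by norm_num, Or.inr (by nlinarith)⟩

theorem half_lt_stretch_iff (a : ℝ) (x : I) : 1 / 2 < (stretch a x : ℝ) ↔ 1 / 2 < (x : ℝ) := by
  have : (1 : ℝ) ≤ max a 1 := le_max_right _ _
  rw [coe_stretch, lt_max_iff, lt_min_iff]
  constructor
  · rintro (h | ⟨-, h⟩)
    · norm_num at h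
    · by_contra h'
      nlinarith
  · intro h
    exact Or.inr ⟨by norm_num, by nlinarith⟩

theorem stretch_eq_half_iff (a : ℝ) (x : I) : (stretch a x : ℝ) = 1 / 2 ↔ (x : ℝ) = 1 / 2 := by
  have h1 := stretch_lt_half_iff a x
  have h2 := half_lt_stretch_iff a x
  constructor <;> intro h <;> apply le_antisymm <;> by_contra! h' <;> grind

theorem eventually_stretch_eq_zero {x : I} (h : (x : ℝ) < 1 / 2) :
    ∀ᶠ a in atTop, stretch a x = 0 := by
  -- This factor solves `1/2 + a (x - 1/2) = 0`.
  filter_upwards [eventually_ge_atTop (1 / (1 - 2 * (x : ℝ)))] with a ha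
  rw [stretch_eq_zero_iff]
  have h1 : 0 < 1 - 2 * (x : ℝ) := by linarith
  rw [div_le_iff₀ h1] at ha
  have h2 := le_max_left a 1
  nlinarith

theorem eventually_stretch_eq_one {x : I} (h : 1 / 2 < (x : ℝ)) :
    ∀ᶠ a in atTop, stretch a x = 1 := by
  filter_upwards [eventually_ge_atTop (1 / (2 * (x : ℝ) - 1))] with a ha
  rw [stretch_eq_one_iff]
  have h1 : 0 < 2 * (x : ℝ) - 1 := by linarith
  rw [div_le_iff₀ h1] at ha
  have h2 := le_max_left a 1
  nlinarith

/-! ### Stretching the realization -/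

variable {X : PrecubicalSet.{u}}

/-- Stretching all coordinates of a point of `Iⁿ`. -/
noncomputable def stretchVec {ι : Type*} (a : ℝ) (x : ι → I) : ι → I := fun i => stretch a (x i)

theorem continuous_stretchVec {ι : Type*} (a : ℝ) :
    Continuous (stretchVec a : (ι → I) → ι → I) :=
  continuous_pi fun i => (continuous_stretch_right a).comp (continuous_apply i)

theorem stretchVec_monotone {ι : Type*} (a : ℝ) : Monotone (stretchVec a : (ι → I) → ι → I) :=
  fun _ _ h i => stretch_monotone a (h i)

theorem stretchVec_stretchVec {ι : Type*} {a b : ℝ} (ha : 1 ≤ a) (hb : 1 ≤ b) (x : ι → I) :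
    stretchVec a (stretchVec b x) = stretchVec (a * b) x :=
  funext fun i => stretch_stretch ha hb (x i)

theorem stretchVec_zero {ι : Type*} (a : ℝ) : stretchVec a (0 : ι → I) = 0 :=
  funext fun _ => stretch_zero a

theorem stretchVec_one {ι : Type*} (a : ℝ) : stretchVec a (1 : ι → I) = 1 :=
  funext fun _ => stretch_one a

theorem stretchVec_insertNth {n : ℕ} (a : ℝ) (i : Fin (n + 1)) (α : Bool) (x : Fin n → I) :
    stretchVec a (i.insertNth (α := fun _ => I) (endpt α) x) =
      i.insertNth (α := fun _ => I) (endpt α) (stretchVec a x) := by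
  funext j
  induction j using i.succAboveCases with
  | x => simp [stretchVec, stretch_endpt]
  | p j => simp [stretchVec]

/-- The self-map of `|X|` that stretches all coordinates. -/
noncomputable def stretchMap (a : ℝ) : X.Realization → X.Realization :=
  Quot.map (fun p => ⟨p.1, stretchVec a p.2⟩) (by
    rintro _ _ ⟨c, α, i, x⟩
    simpa only [stretchVec_insertNth] using Glue.glue c α i (stretchVec a x))

theorem stretchMap_pt (a : ℝ) {n : ℕ} (c : X.cube n) (x : Fin n → I) :
    stretchMap a (pt c x) = pt c (stretchVec a x) := rfl

theorem exists_eq_pt (q : X.Realization) :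
    ∃ (n : ℕ) (c : X.cube n) (x : Fin n → I), q = pt c x := by
  induction q using Quot.ind with
  | mk p => exact ⟨p.1.1, p.1.2, p.2, rfl⟩

theorem stretchMap_vpt (a : ℝ) (v : X.cube 0) : stretchMap a (vpt v) = vpt v := by
  rw [vpt, stretchMap_pt]
  congr 1
  exact Subsingleton.elim _ _

theorem stretchMap_one (q : X.Realization) : stretchMap 1 q = q := by
  obtain ⟨n, c, x, rfl⟩ := exists_eq_pt q
  rw [stretchMap_pt]
  congr 1
  exact funext fun i => stretch_one_left (x i)

theorem stretchMap_stretchMap {a b : ℝ} (ha : 1 ≤ a) (hb : 1 ≤ b) (q : X.Realization) :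
    stretchMap a (stretchMap b q) = stretchMap (a * b) q := by
  obtain ⟨n, c, x, rfl⟩ := exists_eq_pt q
  simp only [stretchMap_pt, stretchVec_stretchVec ha hb]

theorem isQuotientMap_mk : IsQuotientMap (Quot.mk X.Glue : X.Cells → X.Realization) :=
  isQuotientMap_quot_mk

theorem continuous_pt {n : ℕ} (c : X.cube n) : Continuous (pt c) :=
  isQuotientMap_mk.continuous.comp
    (show Continuous (Sigma.mk (β := fun c : Σ n, X.cube n => Fin c.1 → I) ⟨n, c⟩) from
      continuous_sigmaMk)

/-- Since `ℝ` is locally compact, the product of the quotient map with `ℝ` still detects continuity,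
so it suffices to look at one cube at a time. -/
theorem continuous_stretchMap :
    Continuous fun q : ℝ × X.Realization => stretchMap q.1 q.2 := by
  have h := isQuotientMap_mk (X := X)
  have key : Continuous fun q : X.Realization × ℝ => stretchMap q.2 q.1 := by
    refine h.continuous_lift_prod_left ?_
    rw [← Homeomorph.sigmaProdDistrib.symm.comp_continuous_iff', continuous_sigma_iff]
    rintro ⟨n, c⟩
    refine (continuous_pt c).comp (f := fun q : (Fin n → I) × ℝ => stretchVec q.2 q.1) ?_
    refine continuous_pi fun i => ?_
    exact continuous_stretch.comp
      (continuous_snd.prodMk ((continuous_apply i).comp continuous_fst))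
  exact key.comp continuous_swap

/-- Stretching a path. -/
noncomputable def stretchPath (a : ℝ) (p : C(I, X.Realization)) : C(I, X.Realization) where
  toFun s := stretchMap a (p s)
  continuous_toFun := continuous_stretchMap.comp (continuous_const.prodMk p.continuous)

theorem stretchPath_apply (a : ℝ) (p : C(I, X.Realization)) (s : I) :
    stretchPath a p s = stretchMap a (p s) := rfl

theorem continuous_stretchPath :
    Continuous fun q : ℝ × C(I, X.Realization) => stretchPath q.1 q.2 := by
  apply ContinuousMap.continuous_of_continuous_uncurry
  refine continuous_stretchMap.comp (f := fun q : (ℝ × C(I, X.Realization)) × I =>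
    (q.1.1, q.1.2 q.2)) ?_
  exact (continuous_fst.comp continuous_fst).prodMk
    (ContinuousEval.continuous_eval.comp
      ((continuous_snd.comp continuous_fst).prodMk continuous_snd))

theorem stretchPath_one (p : C(I, X.Realization)) : stretchPath 1 p = p :=
  ContinuousMap.ext fun s => stretchMap_one (p s)

theorem stretchPath_stretchPath {a b : ℝ} (ha : 1 ≤ a) (hb : 1 ≤ b) (p : C(I, X.Realization)) :
    stretchPath a (stretchPath b p) = stretchPath (a * b) p :=
  ContinuousMap.ext fun s => stretchMap_stretchMap ha hb (p s)

/-! ### Iterated faces -/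

theorem dist_endpt_of_ne (α β : Bool) (h : α ≠ β) : dist (endpt α) (endpt β) = 1 := by
  rw [Subtype.dist_eq]
  cases α <;> cases β <;> simp_all [endpt]

theorem faceMap_inr {n : ℕ} (z : Fin n → I) : faceMap Sum.inr z = z := rfl

theorem faceMap_insertNth {k n : ℕ} (α : Bool) (i : Fin (n + 1)) (φ : Fin n → Bool ⊕ Fin k)
    (z : Fin k → I) :
    faceMap (i.insertNth (α := fun _ => Bool ⊕ Fin k) (Sum.inl α) φ) z =
      i.insertNth (α := fun _ => I) (endpt α) (faceMap φ z) := by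
  funext j
  induction j using i.succAboveCases with
  | x => simp [faceMap]
  | p j => simp [faceMap]

theorem stretchVec_faceMap {k n : ℕ} (a : ℝ) (φ : Fin n → Bool ⊕ Fin k) (z : Fin k → I) :
    stretchVec a (faceMap φ z) = faceMap φ (stretchVec a z) := by
  funext i
  simp only [stretchVec, faceMap]
  cases φ i with
  | inl α => exact stretch_endpt a α
  | inr j => rfl

theorem continuous_faceMap {k n : ℕ} (φ : Fin n → Bool ⊕ Fin k) : Continuous (faceMap φ) := by
  refine continuous_pi fun i => ?_
  simp only [faceMap]
  cases φ i with
  | inl α => exact continuous_const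
  | inr j => exact continuous_apply j

theorem faceMap_monotone {k n : ℕ} (φ : Fin n → Bool ⊕ Fin k) : Monotone (faceMap φ) := by
  intro z z' h i
  simp only [faceMap]
  cases φ i with
  | inl α => exact le_rfl
  | inr j => exact h j

theorem pt_face {n : ℕ} (c : X.cube (n + 1)) (α : Bool) (i : Fin (n + 1)) (x : Fin n → I) :
    pt (X.face α i c) x = pt c (i.insertNth (α := fun _ => I) (endpt α) x) :=
  Quot.sound (Glue.glue c α i x)

theorem IsFace.pt_eq {k n : ℕ} {e : X.cube k} {c : X.cube n} {φ : Fin n → Bool ⊕ Fin k}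
    (h : IsFace e c φ) (z : Fin k → I) : pt c (faceMap φ z) = pt e z := by
  induction h with
  | refl c => rfl
  | step c α i φ h ih => rw [faceMap_insertNth, ← pt_face, ih]

/-- The free coordinates of a face are numbered by its coordinates. -/
theorem IsFace.exists_index {k n : ℕ} {e : X.cube k} {c : X.cube n} {φ : Fin n → Bool ⊕ Fin k}
    (h : IsFace e c φ) : ∃ f : Fin k → Fin n, ∀ i j, φ i = Sum.inr j ↔ i = f j := by
  induction h with
  | refl c => exact ⟨id, fun i j => by simp⟩
  | step c α i φ h ih =>
    obtain ⟨f, hf⟩ := ih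
    refine ⟨fun j => i.succAbove (f j), fun i' j => ?_⟩
    induction i' using i.succAboveCases with
    | x => simp [(Fin.succAbove_ne i _).symm]
    | p i' => simp [hf]

theorem IsFace.dim_le {k n : ℕ} {e : X.cube k} {c : X.cube n} {φ : Fin n → Bool ⊕ Fin k}
    (h : IsFace e c φ) : k ≤ n := by
  induction h with
  | refl c => exact le_rfl
  | step c α i φ h ih => exact ih.trans (Nat.le_succ _)

theorem IsFace.eq_of_dim_eq {n : ℕ} {e c : X.cube n} {φ : Fin n → Bool ⊕ Fin n}
    (h : IsFace e c φ) : e = c ∧ φ = Sum.inr := by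
  cases h with
  | refl => exact ⟨rfl, rfl⟩
  | step _ α i φ h => exact absurd h.dim_le (by simp)

theorem succAbove_succAbove_of_le {n : ℕ} {i j : Fin (n + 1)} (h : i ≤ j) (l : Fin n) :
    i.castSucc.succAbove (j.succAbove l) = j.succ.succAbove (i.succAbove l) := by
  have h' : (i : ℕ) ≤ j := h
  ext
  simp only [Fin.succAbove, Fin.lt_def]
  split_ifs <;> simp_all <;> omega

/-- A face of `c` on which the `i`-th coordinate is fixed is a face of the `i`-th face of `c`. -/
theorem IsFace.of_apply_eq_inl {k n : ℕ} {e : X.cube k} {c : X.cube (n + 1)}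
    {φ : Fin (n + 1) → Bool ⊕ Fin k} (h : IsFace e c φ) {i : Fin (n + 1)} {α : Bool}
    (hi : φ i = Sum.inl α) : IsFace e (X.face α i c) (fun j => φ (i.succAbove j)) := by
  induction n with
  | zero =>
    cases h with
    | refl => simp at hi
    | step _ β j φ h =>
      obtain rfl : j = i := Subsingleton.elim (α := Fin 1) _ _
      simp only [Fin.insertNth_apply_same, Sum.inl.injEq] at hi
      subst hi
      simpa using h
  | succ n ih =>
    cases h with
    | refl => simp at hi
    | step _ β j φ h =>
      -- If `j ≠ i`, the induction hypothesis removes `i` from the `j`-th face, and the cubical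
      -- identity interchanges the two removals.
      rcases lt_trichotomy i j with hij | rfl | hij
      · obtain ⟨j, rfl⟩ := Fin.exists_succ_eq.2 (Fin.ne_zero_of_lt hij)
        obtain ⟨i, rfl⟩ := Fin.exists_castSucc_eq.2 (Fin.ne_last_of_lt hij)
        have hij' : i ≤ j := Fin.castSucc_lt_succ_iff.1 hij
        have e1 : (j.succ.succAbove i) = i.castSucc := by
          rw [Fin.succAbove_of_castSucc_lt _ _ hij]
        rw [← e1, Fin.insertNth_apply_succAbove] at hi
        have h' := ih h hi
        rw [X.face_face α β i j hij'] at h'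
        have := IsFace.step _ β j _ h'
        convert this using 1
        funext l
        induction l using j.succAboveCases with
        | x =>
          have : i.castSucc.succAbove j = j.succ := by
            rw [Fin.succAbove_of_le_castSucc]; simpa using hij'
          simp [this]
        | p l =>
          simp [succAbove_succAbove_of_le hij']
      · simp only [Fin.insertNth_apply_same, Sum.inl.injEq] at hi
        subst hi
        simpa using h
      · obtain ⟨i, rfl⟩ := Fin.exists_succ_eq.2 (Fin.ne_zero_of_lt hij)
        obtain ⟨j, rfl⟩ := Fin.exists_castSucc_eq.2 (Fin.ne_last_of_lt hij)
        have hij' : j ≤ i := Fin.castSucc_lt_succ_iff.1 hij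
        have e1 : (j.castSucc.succAbove i) = i.succ := by
          rw [Fin.succAbove_of_le_castSucc]; simpa using hij'
        rw [← e1, Fin.insertNth_apply_succAbove] at hi
        have h' := ih h hi
        rw [← X.face_face β α j i hij'] at h'
        have := IsFace.step _ β j _ h'
        convert this using 1
        funext l
        induction l using j.succAboveCases with
        | x =>
          have : i.succ.succAbove j = j.castSucc := by
            rw [Fin.succAbove_of_castSucc_lt _ _ hij]
          simp [this]
        | p l =>
          simp [← succAbove_succAbove_of_le hij']

/-- Every point of a cube is an interior point of a face. -/
theorem exists_carrier {n : ℕ} (c : X.cube n) (x : Fin n → I) :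
    ∃ (k : ℕ) (e : X.cube k) (φ : Fin n → Bool ⊕ Fin k) (z : Fin k → I),
      IsFace e c φ ∧ x = faceMap φ z ∧ ∀ j, z j ≠ 0 ∧ z j ≠ 1 := by
  induction n with
  | zero => exact ⟨0, c, Sum.inr, x, .refl c, rfl, fun j => j.elim0⟩
  | succ n ih =>
    by_cases h : ∃ i α, x i = endpt α
    · obtain ⟨i, α, hi⟩ := h
      obtain ⟨k, e, φ, z, h1, h2, h3⟩ := ih (X.face α i c) (fun j => x (i.succAbove j))
      refine ⟨k, e, _, z, .step c α i φ h1, ?_, h3⟩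
      rw [faceMap_insertNth, ← h2, ← hi]
      exact (Fin.insertNth_self_removeNth i x).symm
    · push Not at h
      exact ⟨n + 1, c, Sum.inr, x, .refl c, rfl, fun j => ⟨h j false, h j true⟩⟩

theorem pt_corner (α : Bool) {n : ℕ} (c : X.cube n) :
    pt c (fun _ => endpt α) = vpt (X.corner α c) := by
  induction n with
  | zero => exact congrArg (pt c) (Subsingleton.elim _ _)
  | succ n ih =>
    rw [corner, ← ih, pt_face]
    congr 1
    funext j
    induction j using Fin.cases <;> simp

/-! ### Small neighbourhoods of a point of the realization -/

/-- `ε` is small compared with the distance of the coordinates of `z` from `0` and `1`. -/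
def Gap {k : ℕ} (z : Fin k → I) (ε : ℝ) : Prop :=
  0 < ε ∧ ε ≤ 1 / 6 ∧ ∀ j, 3 * ε ≤ (z j : ℝ) ∧ (z j : ℝ) ≤ 1 - 3 * ε

theorem eventually_gap {k : ℕ} {z : Fin k → I} (hz : ∀ j, z j ≠ 0 ∧ z j ≠ 1) :
    ∀ᶠ ε in 𝓝[>] (0 : ℝ), Gap z ε := by
  have key : ∀ r : ℝ, 0 < r → ∀ᶠ ε in 𝓝[>] (0 : ℝ), 3 * ε ≤ r := fun r hr => by
    filter_upwards [Ioo_mem_nhdsGT (show (0 : ℝ) < r / 3 by positivity)] with ε hε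
    linarith [hε.2]
  have h1 : ∀ᶠ ε in 𝓝[>] (0 : ℝ), ∀ j, 3 * ε ≤ (z j : ℝ) ∧ 3 * ε ≤ 1 - z j :=
    eventually_all.2 fun j => (key _ (unitInterval.pos_iff_ne_zero.2 (hz j).1)).and
      (key _ (sub_pos.2 (unitInterval.lt_one_iff_ne_one.2 (hz j).2)))
  filter_upwards [h1, key (1 / 2) (by norm_num), self_mem_nhdsWithin] with ε h1 h2 h3
  exact ⟨h3, by linarith, fun j => ⟨(h1 j).1, by linarith [(h1 j).2]⟩⟩

/-- The union of the `ε`-balls about a point of `e` in all cubes that have `e` as a face. -/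
def ptNhd {k : ℕ} (e : X.cube k) (z : Fin k → I) (ε : ℝ) : Set X.Realization :=
  {q | ∃ (n : ℕ) (c : X.cube n) (φ : Fin n → Bool ⊕ Fin k) (y : Fin n → I),
    IsFace e c φ ∧ q = pt c y ∧ dist y (faceMap φ z) < ε}

theorem Gap.le_dist {k : ℕ} {z : Fin k → I} {ε : ℝ} (h : Gap z ε) (j : Fin k) (α : Bool) :
    ε ≤ dist (endpt α) (z j) := by
  have h1 := h.2.2 j
  have h0 := h.1
  rw [Subtype.dist_eq, Real.dist_eq, le_abs]
  cases α
  · right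
    simp only [endpt, Bool.false_eq_true, if_false, Icc.coe_zero]
    linarith
  · left
    simp only [endpt, if_true, Icc.coe_one]
    linarith

/-- This makes `ptNhd` saturated. A coordinate equal to an end point `α` has distance at least `ε`
from all coordinates of `z` and distance `1` from the other end point, so the nearby face must fix
that coordinate at `α` and is a face of the smaller cube. -/
theorem Gap.glue_iff {k : ℕ} {e : X.cube k} {z : Fin k → I} {ε : ℝ} (h : Gap z ε)
    {a b : X.Cells} (hab : X.Glue a b) :
    (∃ φ : Fin a.1.1 → Bool ⊕ Fin k, IsFace e a.1.2 φ ∧ dist a.2 (faceMap φ z) < ε) ↔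
      ∃ φ : Fin b.1.1 → Bool ⊕ Fin k, IsFace e b.1.2 φ ∧ dist b.2 (faceMap φ z) < ε := by
  obtain ⟨c, α, i, x⟩ := hab
  constructor
  · rintro ⟨φ, h1, h2⟩
    refine ⟨_, .step c α i φ h1, ?_⟩
    rw [faceMap_insertNth]
    rw [dist_pi_lt_iff h.1] at h2 ⊢
    rw [Fin.forall_iff_succAbove i]
    simpa [h.1] using h2
  · rintro ⟨φ, h1, h2⟩
    rw [dist_pi_lt_iff h.1, Fin.forall_iff_succAbove i] at h2
    obtain ⟨h2, h3⟩ := h2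
    simp only [Fin.insertNth_apply_same, Fin.insertNth_apply_succAbove] at h2 h3
    have hi : φ i = Sum.inl α := by
      cases h' : φ i with
      | inl β =>
        by_contra hne
        simp only [faceMap, h', Sum.elim_inl] at h2
        rw [dist_endpt_of_ne α β (fun h => hne (by rw [h]))] at h2
        linarith [h.2.1]
      | inr j =>
        simp only [faceMap, h', Sum.elim_inr] at h2
        exact absurd (h.le_dist j α) (not_le.2 h2)
    refine ⟨_, h1.of_apply_eq_inl hi, ?_⟩
    rw [dist_pi_lt_iff h.1]
    exact h3

theorem Gap.pt_mem_iff {k : ℕ} {e : X.cube k} {z : Fin k → I} {ε : ℝ} (h : Gap z ε)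
    {n : ℕ} {c : X.cube n} {y : Fin n → I} :
    pt c y ∈ ptNhd e z ε ↔ ∃ φ, IsFace e c φ ∧ dist y (faceMap φ z) < ε := by
  constructor
  · rintro ⟨n', c', φ, y', h1, h2, h3⟩
    let P : X.Cells → Prop := fun a =>
      ∃ φ : Fin a.1.1 → Bool ⊕ Fin k, IsFace e a.1.2 φ ∧ dist a.2 (faceMap φ z) < ε
    have : P ⟨⟨n, c⟩, y⟩ = P ⟨⟨n', c'⟩, y'⟩ :=
      congrArg (Quot.lift P fun a b hab => propext (h.glue_iff hab)) h2
    exact this.mpr ⟨φ, h1, h3⟩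
  · rintro ⟨φ, h1, h2⟩
    exact ⟨n, c, φ, y, h1, rfl, h2⟩

theorem Gap.isOpen_ptNhd {k : ℕ} {e : X.cube k} {z : Fin k → I} {ε : ℝ} (h : Gap z ε) :
    IsOpen (ptNhd e z ε) := by
  refine isQuotientMap_mk.isOpen_preimage.1 (isOpen_sigma_iff.2 ?_)
  rintro ⟨n, c⟩
  have : Sigma.mk ⟨n, c⟩ ⁻¹' (Quot.mk X.Glue ⁻¹' ptNhd e z ε) =
      ⋃ φ : {φ // IsFace e c φ}, Metric.ball (faceMap φ.1 z) ε := by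
    ext y
    simp only [mem_preimage, mem_iUnion, Metric.mem_ball, Subtype.exists, exists_prop]
    exact h.pt_mem_iff
  rw [this]
  exact isOpen_iUnion fun _ => Metric.isOpen_ball

theorem Gap.self_mem {k : ℕ} {e : X.cube k} {z : Fin k → I} {ε : ℝ} (h : Gap z ε) :
    pt e z ∈ ptNhd e z ε :=
  ⟨k, e, Sum.inr, z, .refl e, rfl, by rw [faceMap_inr, dist_self]; exact h.1⟩

/-- The point lies in its own neighbourhood; testing membership on the other representative exhibits
`e` as a face of `e'`. -/
theorem dim_le_of_pt_eq {k k' : ℕ} {e : X.cube k} {e' : X.cube k'} {z : Fin k → I}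
    {z' : Fin k' → I} (hz : ∀ j, z j ≠ 0 ∧ z j ≠ 1) (h : pt e z = pt e' z') : k ≤ k' := by
  obtain ⟨ε, hε⟩ := (eventually_gap hz).exists
  have := hε.self_mem (e := e)
  rw [h, hε.pt_mem_iff] at this
  obtain ⟨φ, h1, -⟩ := this
  exact h1.dim_le

theorem eq_of_pt_eq {k : ℕ} {e e' : X.cube k} {z z' : Fin k → I} (hz : ∀ j, z j ≠ 0 ∧ z j ≠ 1)
    (h : pt e z = pt e' z') : e = e' ∧ z = z' := by
  -- In equal dimensions the face found by the membership test is the cube itself, at every small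
  -- scale; then let `ε` tend to `0`.
  have key : ∀ᶠ ε in 𝓝[>] (0 : ℝ), e = e' ∧ dist z' z ≤ ε := by
    filter_upwards [eventually_gap hz] with ε hε
    have := hε.self_mem (e := e)
    rw [h, hε.pt_mem_iff] at this
    obtain ⟨φ, h1, h2⟩ := this
    obtain ⟨h3, rfl⟩ := h1.eq_of_dim_eq
    exact ⟨h3, h2.le⟩
  have h1 : dist z' z ≤ 0 :=
    ge_of_tendsto (tendsto_id.mono_left nhdsWithin_le_nhds) (key.mono fun _ h => h.2)
  obtain ⟨ε, h2, -⟩ := key.exists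
  exact ⟨h2, (dist_le_zero.1 h1).symm⟩

/-- Two points of a cube have the same coordinates equal to `0` and to `1`. -/
def SameCarrier {n : ℕ} (v x : Fin n → I) : Prop :=
  ∀ i, (v i = 0 ↔ x i = 0) ∧ (v i = 1 ↔ x i = 1)

theorem SameCarrier.faceMap {k n : ℕ} (φ : Fin n → Bool ⊕ Fin k) {z w : Fin k → I}
    (hz : ∀ j, z j ≠ 0 ∧ z j ≠ 1) (hw : ∀ j, w j ≠ 0 ∧ w j ≠ 1) :
    SameCarrier (faceMap φ w) (PrecubicalSet.faceMap φ z) := by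
  intro i
  simp only [PrecubicalSet.faceMap]
  cases φ i with
  | inl α => simp
  | inr j => simp [hz j, hw j]

/-- Two points of a cube in the interior of the same face that agree in `|X|` are equal. -/
theorem SameCarrier.eq_of_pt_eq {n : ℕ} {d : X.cube n} {v v' : Fin n → I}
    (hv : SameCarrier v v') (h : pt d v = pt d v') : v = v' := by
  obtain ⟨k, e, φ, z, h1, rfl, h3⟩ := exists_carrier d v
  obtain ⟨f, hf⟩ := h1.exists_index
  have h4 : v' = PrecubicalSet.faceMap φ (fun j => v' (f j)) := by
    funext i
    have := hv i
    simp only [PrecubicalSet.faceMap] at this ⊢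
    cases h' : φ i with
    | inl α =>
      rw [h'] at this
      cases α
      · exact this.1.1 rfl
      · exact this.2.1 rfl
    | inr j => rw [(hf i j).1 h', Sum.elim_inr]
  rw [h4, h1.pt_eq, h1.pt_eq] at h
  rw [h4, (PrecubicalSet.eq_of_pt_eq h3 h).2]

theorem SameCarrier.symm {n : ℕ} {v x : Fin n → I} (h : SameCarrier v x) : SameCarrier x v :=
  fun i => ⟨(h i).1.symm, (h i).2.symm⟩

theorem SameCarrier.trans {n : ℕ} {v x y : Fin n → I} (h : SameCarrier v x)
    (h' : SameCarrier x y) : SameCarrier v y :=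
  fun i => ⟨(h i).1.trans (h' i).1, (h i).2.trans (h' i).2⟩

/-! ### Charts -/

/-- Stretching by this factor collapses `[0, 2ε]` and `[1 - 2ε, 1]`. -/
noncomputable def scale (ε : ℝ) : ℝ := (1 - 4 * ε)⁻¹

theorem Gap.one_lt_scale {k : ℕ} {z : Fin k → I} {ε : ℝ} (h : Gap z ε) : 1 < scale ε := by
  have h1 := h.1
  have h2 := h.2.1
  exact (one_lt_inv₀ (by linarith)).2 (by linarith)

theorem Gap.max_scale {k : ℕ} {z : Fin k → I} {ε : ℝ} (h : Gap z ε) :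
    max (scale ε) 1 = (1 - 4 * ε)⁻¹ := max_eq_left h.one_lt_scale.le

theorem Gap.stretch_eq_zero_iff {k : ℕ} {z : Fin k → I} {ε : ℝ} (h : Gap z ε) (x : I) :
    stretch (scale ε) x = 0 ↔ (x : ℝ) ≤ 2 * ε := by
  have h2 : 0 < 1 - 4 * ε := by linarith [h.2.1]
  rw [PrecubicalSet.stretch_eq_zero_iff, h.max_scale]
  field_simp
  constructor <;> intro h <;> linarith

theorem Gap.stretch_eq_one_iff {k : ℕ} {z : Fin k → I} {ε : ℝ} (h : Gap z ε) (x : I) :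
    stretch (scale ε) x = 1 ↔ 1 - 2 * ε ≤ (x : ℝ) := by
  have h2 : 0 < 1 - 4 * ε := by linarith [h.2.1]
  rw [PrecubicalSet.stretch_eq_one_iff, h.max_scale]
  field_simp
  constructor <;> intro h <;> linarith

/-- Off the cuts the displacement is `4ε |x - 1/2| / (1 - 4ε)`, and there `|x - 1/2|` is less than
`(1 - 4ε) / 2`. -/
theorem Gap.dist_stretch_le {k : ℕ} {z : Fin k → I} {ε : ℝ} (h : Gap z ε) (x : I) :
    dist (stretch (scale ε) x) x ≤ 2 * ε := by
  have h1 := h.1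
  have h2 : 0 < 1 - 4 * ε := by linarith [h.2.1]
  rw [Subtype.dist_eq, Real.dist_eq, abs_le]
  have hx0 := x.2.1
  have hx1 := x.2.2
  by_cases h3 : stretch (scale ε) x = 0
  · rw [h3]
    rw [h.stretch_eq_zero_iff] at h3
    constructor <;> simp <;> linarith
  by_cases h4 : stretch (scale ε) x = 1
  · rw [h4]
    rw [h.stretch_eq_one_iff] at h4
    constructor <;> simp <;> linarith
  rw [coe_stretch_of_ne h3 h4, h.max_scale]
  rw [h.stretch_eq_zero_iff, not_le] at h3
  rw [h.stretch_eq_one_iff, not_le] at h4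
  have h5 : (1 - 4 * ε)⁻¹ * ((x : ℝ) - 1 / 2) - (x - 1 / 2) =
      (4 * ε * (x - 1 / 2)) / (1 - 4 * ε) := by
    field_simp
    ring
  have h6 : (1 : ℝ) / 2 + (1 - 4 * ε)⁻¹ * (x - 1 / 2) - x =
      (4 * ε * (x - 1 / 2)) / (1 - 4 * ε) := by rw [← h5]; ring
  rw [h6, le_div_iff₀ h2, div_le_iff₀ h2]
  constructor <;> nlinarith

theorem Gap.stretchVec_eq {k n : ℕ} {z : Fin k → I} {ε : ℝ} (h : Gap z ε)
    {φ : Fin n → Bool ⊕ Fin k} {f : Fin k → Fin n} (hf : ∀ i j, φ i = Sum.inr j ↔ i = f j)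
    {y : Fin n → I} (h0 : ∀ i, φ i = Sum.inl false → (y i : ℝ) ≤ 2 * ε)
    (h1 : ∀ i, φ i = Sum.inl true → 1 - 2 * ε ≤ (y i : ℝ)) :
    stretchVec (scale ε) y = faceMap φ (fun j => stretch (scale ε) (y (f j))) := by
  funext i
  simp only [stretchVec, faceMap]
  cases h' : φ i with
  | inl α =>
    cases α
    · exact (h.stretch_eq_zero_iff _).2 (h0 i h')
    · exact (h.stretch_eq_one_iff _).2 (h1 i h')
  | inr j => rw [(hf i j).1 h', Sum.elim_inr]

/-- Fixed coordinates lie within `ε` of an end point, hence inside the zone of width `2ε` that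
`scale ε` collapses; free ones keep distance more than `3ε - ε` from both ends. The thresholds `2ε`
and `1 - 2ε` are therefore never met, and a continuous path cannot change zones. -/
theorem Gap.side {k n : ℕ} {z : Fin k → I} {ε : ℝ} (h : Gap z ε)
    {φ : Fin n → Bool ⊕ Fin k} {y : Fin n → I} (hy : dist y (faceMap φ z) < ε) (i : Fin n) :
    (φ i = Sum.inl false → (y i : ℝ) < 2 * ε) ∧ (φ i = Sum.inl true → 1 - 2 * ε < (y i : ℝ)) ∧
    (∀ j, φ i = Sum.inr j → 2 * ε < (y i : ℝ) ∧ (y i : ℝ) < 1 - 2 * ε) := by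
  rw [dist_pi_lt_iff h.1] at hy
  have h1 := hy i
  have h0 := h.1
  rw [Subtype.dist_eq, Real.dist_eq, abs_lt] at h1
  simp only [faceMap] at h1
  refine ⟨fun h' => ?_, fun h' => ?_, fun j h' => ?_⟩
  · simp only [h', Sum.elim_inl, endpt, Bool.false_eq_true, if_false, Icc.coe_zero] at h1
    linarith
  · simp only [h', Sum.elim_inl, endpt, if_true, Icc.coe_one] at h1
    linarith
  · simp only [h', Sum.elim_inr] at h1
    have := h.2.2 j
    constructor <;> linarith

theorem Gap.ne_side {k n : ℕ} {z : Fin k → I} {ε : ℝ} (h : Gap z ε)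
    {φ : Fin n → Bool ⊕ Fin k} {y : Fin n → I} (hy : dist y (faceMap φ z) < ε) (i : Fin n) :
    (y i : ℝ) ≠ 2 * ε ∧ (y i : ℝ) ≠ 1 - 2 * ε := by
  have h0 := h.2.1
  obtain ⟨h1, h2, h3⟩ := h.side hy i
  cases h' : φ i with
  | inl α =>
    cases α
    · have := h1 h'
      constructor <;> intro h <;> linarith
    · have := h2 h'
      constructor <;> intro h <;> linarith
  | inr j =>
    have := h3 j h'
    constructor <;> intro h <;> linarith

theorem lt_of_forall_ne {f : I → ℝ} {a b : I} {r : ℝ} (hf : ContinuousOn f (Icc a b))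
    (hr : ∀ s ∈ Icc a b, f s ≠ r) {s s' : I} (hs : s ∈ Icc a b) (hs' : s' ∈ Icc a b)
    (h : f s < r) : f s' < r := by
  by_contra! h'
  have hsub : uIcc s s' ⊆ Icc a b := ordConnected_Icc.uIcc_subset hs hs'
  obtain ⟨τ, h1, h2⟩ := intermediate_value_uIcc (hf.mono hsub) (Icc_subset_uIcc ⟨h.le, h'⟩)
  exact hr τ (hsub h1) h2

/-- A path near an interior point of a face of `d` becomes, after stretching, a path in that
face. -/
theorem Gap.exists_lift {k m n : ℕ} {z : Fin k → I} {ε : ℝ} (h : Gap z ε) {e : X.cube k}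
    {d : X.cube m} {ψ : Fin m → Bool ⊕ Fin k} (hψ : IsFace e d ψ) {u : X.cube n}
    {β : I → Fin n → I} {a b : I} (hab : a ≤ b) (hβ : Increasing β a b)
    (hm : ∀ s ∈ Icc a b, pt u (β s) ∈ ptNhd e z ε) :
    ∃ v : I → Fin m → I, Increasing v a b ∧ dist (v a) (faceMap ψ z) ≤ 3 * ε ∧
      ∀ s ∈ Icc a b, stretchMap (scale ε) (pt u (β s)) = pt d (v s) ∧
        SameCarrier (v s) (faceMap ψ z) := by
  have h0 := h.1
  have hε := h.2.1
  have hc : ∀ i, ContinuousOn (fun s => (β s i : ℝ)) (Icc a b) := fun i =>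
    continuous_subtype_val.comp_continuousOn (continuousOn_pi.1 hβ.1 i)
  have hm' : ∀ s ∈ Icc a b, ∀ i, (β s i : ℝ) ≠ 2 * ε ∧ (β s i : ℝ) ≠ 1 - 2 * ε := by
    intro s hs i
    obtain ⟨φ, -, h2⟩ := h.pt_mem_iff.1 (hm s hs)
    exact h.ne_side h2 i
  have haa : a ∈ Icc a b := left_mem_Icc.2 hab
  -- The cube `e` may be a face of `u` in several ways. The partition found at time `a` serves the
  -- whole interval because no coordinate crosses a threshold.
  obtain ⟨φ, hφ, hd⟩ := h.pt_mem_iff.1 (hm a haa)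
  obtain ⟨f, hf⟩ := hφ.exists_index
  have lt_lo : ∀ s ∈ Icc a b, ∀ i, (β s i : ℝ) < 2 * ε ↔ (β a i : ℝ) < 2 * ε := fun s hs i =>
    ⟨lt_of_forall_ne (hc i) (fun s hs => (hm' s hs i).1) hs haa,
      lt_of_forall_ne (hc i) (fun s hs => (hm' s hs i).1) haa hs⟩
  have lt_hi : ∀ s ∈ Icc a b, ∀ i, (β s i : ℝ) < 1 - 2 * ε ↔ (β a i : ℝ) < 1 - 2 * ε :=
    fun s hs i => ⟨lt_of_forall_ne (hc i) (fun s hs => (hm' s hs i).2) hs haa,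
      lt_of_forall_ne (hc i) (fun s hs => (hm' s hs i).2) haa hs⟩
  have hsv : ∀ s ∈ Icc a b, stretchVec (scale ε) (β s) =
      faceMap φ (fun j => stretch (scale ε) (β s (f j))) := fun s hs =>
    h.stretchVec_eq hf (fun i hi => ((lt_lo s hs i).2 ((h.side hd i).1 hi)).le)
      (fun i hi => by
        have := mt (lt_hi s hs i).1 (not_lt.2 ((h.side hd i).2.1 hi).le)
        linarith)
  have hint : ∀ s ∈ Icc a b, ∀ j, stretch (scale ε) (β s (f j)) ≠ 0 ∧
      stretch (scale ε) (β s (f j)) ≠ 1 := fun s hs j => by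
    have h1 := (h.side hd (f j)).2.2 j ((hf _ _).2 rfl)
    have h2 := mt (lt_lo s hs (f j)).1 (not_lt.2 h1.1.le)
    have h3 := (lt_hi s hs (f j)).2 h1.2
    have h4 := (hm' s hs (f j)).1
    rw [Ne, Ne, h.stretch_eq_zero_iff, h.stretch_eq_one_iff]
    exact ⟨fun h5 => h4 (le_antisymm h5 (not_lt.1 h2)), fun h5 => by linarith⟩
  have hz : ∀ j, z j ≠ 0 ∧ z j ≠ 1 := fun j => by
    have := h.2.2 j
    constructor <;> intro h' <;> rw [h'] at this <;> simp at this <;> linarith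
  -- After stretching the path lies in `e`; `ψ` carries it from there into `d`.
  refine ⟨fun s => faceMap ψ (fun j => stretch (scale ε) (β s (f j))), ⟨?_, ?_⟩, ?_, fun s hs => ?_⟩
  · refine (continuous_faceMap ψ).comp_continuousOn (continuousOn_pi.2 fun j => ?_)
    exact (continuous_stretch_right _).comp_continuousOn (continuousOn_pi.1 hβ.1 (f j))
  · intro s hs s' hs' hss'
    exact faceMap_monotone ψ fun j => stretch_monotone _ (hβ.2 hs hs' hss' (f j))
  · rw [dist_pi_le_iff (by positivity)]
    intro i
    simp only [faceMap]
    cases ψ i with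
    | inl α => simp; positivity
    | inr j =>
      rw [dist_pi_lt_iff h.1] at hd
      have h1 := hd (f j)
      rw [faceMap, (hf (f j) j).2 rfl, Sum.elim_inr] at h1
      have h2 := h.dist_stretch_le (β a (f j))
      simp only [Sum.elim_inr]
      linarith [dist_triangle (stretch (scale ε) (β a (f j))) (β a (f j)) (z j)]
  · refine ⟨?_, SameCarrier.faceMap ψ hz (hint s hs)⟩
    rw [stretchMap_pt, hsv s hs, hφ.pt_eq, hψ.pt_eq]

theorem Gap.exists_lift_point {k m : ℕ} {z : Fin k → I} {ε : ℝ} (h : Gap z ε) {e : X.cube k}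
    {d : X.cube m} {ψ : Fin m → Bool ⊕ Fin k} (hψ : IsFace e d ψ) {q : X.Realization}
    (hq : q ∈ ptNhd e z ε) :
    ∃ v, dist v (faceMap ψ z) ≤ 3 * ε ∧ stretchMap (scale ε) q = pt d v ∧
      SameCarrier v (faceMap ψ z) := by
  obtain ⟨n, u, y, rfl⟩ := exists_eq_pt q
  obtain ⟨v, -, h2, h3⟩ := h.exists_lift hψ (β := fun _ => y) (le_refl (0 : I))
    ⟨continuousOn_const, monotoneOn_const⟩ (fun _ _ => hq)
  exact ⟨v 0, h2, h3 0 (left_mem_Icc.2 le_rfl)⟩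

/-- If two points cannot be separated, their `ε`-neighbourhoods meet for all small `ε`. Stretching a
common point by `scale ε` puts it in the open cells of both carriers, within `3ε` of both points;
uniqueness of carriers identifies the cells, and `ε → 0` the points. -/
instance : T2Space X.Realization := by
  refine ⟨fun q q' hne => ?_⟩
  by_contra hsep
  obtain ⟨n, c, x, rfl⟩ := exists_eq_pt q
  obtain ⟨n', c', x', rfl⟩ := exists_eq_pt q'
  obtain ⟨k, e, φ, z, h1, rfl, hz⟩ := exists_carrier c x
  obtain ⟨k', e', φ', z', h1', rfl, hz'⟩ := exists_carrier c' x'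
  rw [h1.pt_eq, h1'.pt_eq] at hne hsep
  have key : ∀ ε, Gap z ε → Gap z' ε → ∃ w w', pt e w = pt e' w' ∧ dist w z ≤ 3 * ε ∧
      dist w' z' ≤ 3 * ε ∧ SameCarrier w z ∧ SameCarrier w' z' := by
    intro ε hε hε'
    by_contra hcon
    refine hsep ⟨_, _, hε.isOpen_ptNhd (e := e), hε'.isOpen_ptNhd (e := e'), hε.self_mem,
      hε'.self_mem, disjoint_left.2 fun q hq hq' => hcon ?_⟩
    obtain ⟨w, h1, h2, h3⟩ := hε.exists_lift_point (.refl e) hq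
    obtain ⟨w', h1', h2', h3'⟩ := hε'.exists_lift_point (.refl e') hq'
    exact ⟨w, w', h2.symm.trans h2', h1, h1', h3, h3'⟩
  have hint : ∀ {k : ℕ} {z w : Fin k → I}, (∀ j, z j ≠ 0 ∧ z j ≠ 1) → SameCarrier w z →
      ∀ j, w j ≠ 0 ∧ w j ≠ 1 := fun hz h j =>
    ⟨fun h' => (hz j).1 ((h j).1.1 h'), fun h' => (hz j).2 ((h j).2.1 h')⟩
  have hev := (eventually_gap hz).and (eventually_gap hz')
  obtain ⟨ε, hε, hε'⟩ := hev.exists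
  obtain ⟨w, w', hw, -, -, hc, hc'⟩ := key ε hε hε'
  obtain rfl : k = k' :=
    le_antisymm (dim_le_of_pt_eq (hint hz hc) hw) (dim_le_of_pt_eq (hint hz' hc') hw.symm)
  obtain rfl := (eq_of_pt_eq (hint hz hc) hw).1
  have hd : ∀ᶠ ε in 𝓝[>] (0 : ℝ), dist z z' ≤ 6 * ε := by
    filter_upwards [hev] with ε hε
    obtain ⟨w, w', hw, h1, h2, hc, hc'⟩ := key ε hε.1 hε.2
    obtain rfl := (eq_of_pt_eq (hint hz hc) hw).2
    linarith [dist_triangle_left z z' w]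
  have hlim : Tendsto (fun ε : ℝ => 6 * ε) (𝓝[>] 0) (𝓝 0) := by
    have : Continuous fun ε : ℝ => 6 * ε := by fun_prop
    simpa using (this.tendsto 0).mono_left nhdsWithin_le_nhds
  exact hne (by rw [dist_le_zero.1 (ge_of_tendsto hlim hd)])

/-! ### Subdivisions -/

theorem IsSubdivision.exists_mem_Icc {l : ℕ} {t : Fin (l + 1) → I} (ht : IsSubdivision t) (s : I) :
    ∃ k : Fin l, s ∈ Icc (t k.castSucc) (t k.succ) := by
  have key : ∀ k : Fin (l + 1), s ≤ t k →
      (∃ k : Fin l, s ∈ Icc (t k.castSucc) (t k.succ)) ∨ s ≤ t 0 := by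
    intro k
    induction k using Fin.induction with
    | zero => exact Or.inr
    | succ k ih =>
      intro h
      rcases le_total s (t k.castSucc) with h' | h'
      · exact ih h'
      · exact Or.inl ⟨k, h', h⟩
  rcases key (Fin.last l) (ht.2.2 ▸ le_one') with h | h
  · exact h
  · cases l with
    | zero => exact absurd (ht.2.1.symm.trans ht.2.2) zero_ne_one
    | succ l =>
      refine ⟨0, ?_, h.trans (ht.1 (Fin.zero_le _))⟩
      rw [Fin.castSucc_zero, ht.2.1]
      exact nonneg'

theorem Increasing.mono {n : ℕ} {β : I → Fin n → I} {a b a' b' : I} (h : Increasing β a b)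
    (hsub : Icc a' b' ⊆ Icc a b) : Increasing β a' b' :=
  ⟨h.1.mono hsub, h.2.mono hsub⟩

theorem Presents.mono {n : ℕ} {p : C(I, X.Realization)} {c : X.cube n} {β : I → Fin n → I}
    {a b a' b' : I} (h : Presents p a b c β) (hsub : Icc a' b' ⊆ Icc a b) :
    Presents p a' b' c β :=
  fun s hs => h s (hsub hs)

/-- A property of intervals that holds for the pieces of a d-path and that is stable under
concatenation holds for all intervals. -/
theorem IsDPath.interval_induction {p : C(I, X.Realization)} (hp : IsDPath p) {Q : I → I → Prop}
    (piece : ∀ a b, a ≤ b → ∀ (n : ℕ) (c : X.cube n) (β : I → Fin n → I),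
      Increasing β a b → Presents p a b c β → Q a b)
    (trans : ∀ a b c, a ≤ b → b ≤ c → Q a b → Q b c → Q a c) {a b : I} (hab : a ≤ b) :
    Q a b := by
  obtain ⟨l, t, ht, h⟩ := hp
  have hpiece : ∀ k : Fin l, ∀ a b, a ≤ b → t k.castSucc ≤ a → b ≤ t k.succ → Q a b := by
    intro k a b hab ha hb
    obtain ⟨n, c, β, h1, h2⟩ := h k
    have hsub : Icc a b ⊆ Icc (t k.castSucc) (t k.succ) := Icc_subset_Icc ha hb
    exact piece a b hab n c β (h1.mono hsub) (h2.mono hsub)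
  have key : ∀ k : Fin (l + 1), ∀ a b, a ≤ b → b ≤ t k → Q a b := by
    intro k
    induction k using Fin.induction with
    | zero =>
      intro a b hab hb
      rw [ht.2.1] at hb
      obtain rfl : b = 0 := le_antisymm hb nonneg'
      obtain rfl : a = 0 := le_antisymm hab nonneg'
      obtain ⟨k, hk⟩ := ht.exists_mem_Icc 0
      exact hpiece k 0 0 le_rfl hk.1 hk.2
    | succ k ih =>
      intro a b hab hb
      rcases le_total b (t k.castSucc) with h1 | h1
      · exact ih a b hab h1
      rcases le_total (t k.castSucc) a with h2 | h2
      · exact hpiece k a b hab h2 hb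
      · exact trans _ _ _ h2 h1 (ih _ _ h2 le_rfl) (hpiece k _ _ h1 le_rfl hb)
  exact key (Fin.last l) a b hab (ht.2.2 ▸ le_one')

/-! ### Paths in a cube -/

theorem Increasing.ite {n : ℕ} {β γ : I → Fin n → I} {a b c : I}
    (hβ : Increasing β a b) (hγ : Increasing γ b c) (h : β b = γ b) :
    Increasing (fun s => if s ≤ b then β s else γ s) a c := by
  have h1 : EqOn (fun s => if s ≤ b then β s else γ s) β (Icc a b) := fun s hs => if_pos hs.2
  have h2 : EqOn (fun s => if s ≤ b then β s else γ s) γ (Icc b c) := fun s hs => by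
    rcases hs.1.eq_or_lt with rfl | h'
    · simp [h]
    · exact if_neg (not_le.2 h')
  constructor
  · have := (hβ.1.congr h1).union_of_isClosed (hγ.1.congr h2) isClosed_Icc isClosed_Icc
    exact this.mono fun s hs => (le_total s b).imp (fun h => ⟨hs.1, h⟩) (fun h => ⟨h, hs.2⟩)
  · intro s hs s' hs' hss'
    dsimp only
    split_ifs with h3 h4 h4
    · exact hβ.2 ⟨hs.1, h3⟩ ⟨hs'.1, h4⟩ hss'
    · have h5 := not_le.1 h4
      refine (hβ.2 ⟨hs.1, h3⟩ (right_mem_Icc.2 (hs.1.trans h3)) h3).trans ?_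
      rw [h]
      exact hγ.2 (left_mem_Icc.2 (h5.le.trans hs'.2)) ⟨h5.le, hs'.2⟩ h5.le
    · exact absurd (hss'.trans h4) h3
    · exact hγ.2 ⟨(not_le.1 h3).le, hs.2⟩ ⟨(not_le.1 h4).le, hs'.2⟩ hss'

/-- Over `[a,b]` the path `p` is a directed path in the cube `d` from `x` to `y`. -/
def RunsIn {m : ℕ} (p : C(I, X.Realization)) (d : X.cube m) (a b : I) (x y : Fin m → I) : Prop :=
  ∃ β : I → Fin m → I, Increasing β a b ∧ Presents p a b d β ∧ β a = x ∧ β b = y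

theorem RunsIn.trans {m : ℕ} {p : C(I, X.Realization)} {d : X.cube m} {a b c : I}
    {x y z : Fin m → I} (hab : a ≤ b) (hbc : b ≤ c) (h : RunsIn p d a b x y)
    (h' : RunsIn p d b c y z) : RunsIn p d a c x z := by
  obtain ⟨β, h1, h2, h3, h4⟩ := h
  obtain ⟨γ, k1, k2, k3, k4⟩ := h'
  refine ⟨_, h1.ite k1 (h4.trans k3.symm), fun s hs => ?_, by simp [hab, h3], ?_⟩
  · dsimp only
    split_ifs with h5
    · exact h2 s ⟨hs.1, h5⟩
    · exact k2 s ⟨(not_le.1 h5).le, hs.2⟩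
  · split_ifs with h5
    · obtain rfl := le_antisymm hbc h5
      rw [h4, ← k3, k4]
    · exact k4

theorem Increasing.stretchVec {n : ℕ} {β : I → Fin n → I} {s s' : I} (h : Increasing β s s')
    (a : ℝ) : Increasing (fun τ => stretchVec a (β τ)) s s' :=
  ⟨(continuous_stretchVec a).comp_continuousOn h.1, (stretchVec_monotone a).comp_monotoneOn h.2⟩

theorem Presents.stretchVec {n : ℕ} {p : C(I, X.Realization)} {c : X.cube n} {β : I → Fin n → I}
    {s s' : I} (h : Presents p s s' c β) (a : ℝ) :
    Presents (stretchPath a p) s s' c (fun τ => stretchVec a (β τ)) :=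
  fun τ hτ => by rw [stretchPath_apply, h τ hτ, stretchMap_pt]

/-! ### Paths near a path in a cube -/

/-- The neighbourhood is that of the carrier of `x`, and `ν = scale ε` is as close to `1` as
desired. Two lifts of one point to the same open face of `d` coincide, so the lifts of successive
pieces of a d-path fit together. -/
theorem exists_chart {m : ℕ} (d : X.cube m) (x : Fin m → I) {δ : ℝ} (hδ : 0 < δ) :
    ∃ (ν : ℝ) (V : Set X.Realization), 1 < ν ∧ ν < 1 + δ ∧ IsOpen V ∧ pt d x ∈ V ∧
      SameCarrier (stretchVec ν x) x ∧
      (∀ q ∈ V, ∃ v, dist v x < δ ∧ stretchMap ν q = pt d v ∧ SameCarrier v x) ∧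
      ∀ p : C(I, X.Realization), IsDPath p → ∀ s s', s ≤ s' → (∀ τ ∈ Icc s s', p τ ∈ V) →
        ∃ v : I → Fin m → I, Increasing v s s' ∧ ∀ τ ∈ Icc s s',
          stretchMap ν (p τ) = pt d (v τ) ∧ SameCarrier (v τ) x := by
  obtain ⟨k, e, ψ, z, hψ, rfl, hz⟩ := exists_carrier d x
  have hlim : Tendsto scale (𝓝[>] 0) (𝓝 1) := by
    have : ContinuousAt scale 0 := by
      unfold scale
      exact ContinuousAt.inv₀ (by fun_prop) (by norm_num)
    have h0 : scale 0 = 1 := by simp [scale]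
    simpa [h0] using this.tendsto.mono_left nhdsWithin_le_nhds
  obtain ⟨ε, hε, h1, h2⟩ := ((eventually_gap hz).and ((hlim.eventually_lt_const
    (show (1 : ℝ) < 1 + δ by linarith)).and
    (Ioo_mem_nhdsGT (show (0 : ℝ) < δ / 3 by positivity)))).exists
  refine ⟨scale ε, ptNhd e z ε, hε.one_lt_scale, h1, hε.isOpen_ptNhd,
    hψ.pt_eq z ▸ hε.self_mem, ?_, fun q hq => ?_, fun p hp s s' hss' => ?_⟩
  · rw [stretchVec_faceMap]
    refine SameCarrier.faceMap ψ hz fun j => ?_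
    have h3 := hε.2.2 j
    have h0 := hε.1
    simp only [stretchVec, Ne, hε.stretch_eq_zero_iff, hε.stretch_eq_one_iff, not_le]
    constructor <;> linarith
  · obtain ⟨v, h3, h4⟩ := hε.exists_lift_point hψ hq
    exact ⟨v, by linarith [h2.2], h4⟩
  · refine hp.interval_induction (Q := fun s s' => (∀ τ ∈ Icc s s', p τ ∈ ptNhd e z ε) →
      ∃ v : I → Fin m → I, Increasing v s s' ∧ ∀ τ ∈ Icc s s',
        stretchMap (scale ε) (p τ) = pt d (v τ) ∧ SameCarrier (v τ) (faceMap ψ z)) ?_ ?_ hss'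
    · intro a b hab n c β hβ hpr hm
      obtain ⟨v, k1, -, k2⟩ := hε.exists_lift hψ hab hβ fun s hs => hpr s hs ▸ hm s hs
      exact ⟨v, k1, fun s hs => hpr s hs ▸ k2 s hs⟩
    · intro a b c hab hbc h3 h4 hm
      obtain ⟨v, k1, k2⟩ := h3 fun τ hτ => hm τ ⟨hτ.1, hτ.2.trans hbc⟩
      obtain ⟨w, k3, k4⟩ := h4 fun τ hτ => hm τ ⟨hab.trans hτ.1, hτ.2⟩
      have hb := k2 b (right_mem_Icc.2 hab)
      have hb' := k4 b (left_mem_Icc.2 hbc)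
      refine ⟨_, k1.ite k3 ((hb.2.trans hb'.2.symm).eq_of_pt_eq (hb.1.symm.trans hb'.1)),
        fun τ hτ => ?_⟩
      split_ifs with h5
      · exact k2 τ ⟨hτ.1, h5⟩
      · exact k4 τ ⟨(not_le.1 h5).le, hτ.2⟩

/-- For `ν > 1`, end-point coordinates lie strictly beyond the cuts, and by hypothesis the others
lie strictly between them. These are open conditions on the point and the factor. -/
theorem SameCarrier.eventually {m : ℕ} {ν : ℝ} (hν : 1 < ν) {x : Fin m → I}
    (h : SameCarrier (stretchVec ν x) x) :
    ∃ r > 0, ∀ (v : Fin m → I) (ν' : ℝ), dist v x < r → 1 ≤ ν' → ν' < 1 + r →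
      SameCarrier (stretchVec (ν / ν') v) x ∧ ν' ≤ ν := by
  have key : ∀ i, ∀ᶠ w : (Fin m → I) × ℝ in 𝓝 (x, 1),
      (stretch (ν / w.2) (w.1 i) = 0 ↔ x i = 0) ∧ (stretch (ν / w.2) (w.1 i) = 1 ↔ x i = 1) := by
    intro i
    have hc : ContinuousAt (fun w : (Fin m → I) × ℝ =>
        1 / 2 + max (ν / w.2) 1 * ((w.1 i : ℝ) - 1 / 2)) (x, 1) := by
      have h1 : ContinuousAt (fun w : (Fin m → I) × ℝ => ν / w.2) (x, 1) :=
        continuousAt_const.div continuousAt_snd one_ne_zero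
      have h2 : ContinuousAt (fun w : (Fin m → I) × ℝ => (w.1 i : ℝ)) (x, 1) := by fun_prop
      exact continuousAt_const.add
        ((h1.max continuousAt_const).mul (h2.sub continuousAt_const))
    have hi := h i
    simp only [PrecubicalSet.stretchVec, PrecubicalSet.stretch_eq_zero_iff,
      PrecubicalSet.stretch_eq_one_iff] at hi ⊢
    have hm : max ν 1 = ν := max_eq_left hν.le
    rw [hm] at hi
    by_cases h0 : x i = 0
    · have : (1 / 2 + max (ν / ((x, 1) : (Fin m → I) × ℝ).2) 1 *
          ((((x, 1) : (Fin m → I) × ℝ).1 i : ℝ) - 1 / 2)) < 0 := by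
        simp only [div_one, hm, h0, Icc.coe_zero]
        linarith
      filter_upwards [hc.eventually_lt_const this] with w hw
      simp only [h0, iff_true, zero_ne_one, iff_false, not_le]
      exact ⟨hw.le, by linarith⟩
    by_cases h1 : x i = 1
    · have : 1 < (1 / 2 + max (ν / ((x, 1) : (Fin m → I) × ℝ).2) 1 *
          ((((x, 1) : (Fin m → I) × ℝ).1 i : ℝ) - 1 / 2)) := by
        simp only [div_one, hm, h1, Icc.coe_one]
        linarith
      filter_upwards [hc.eventually_const_lt this] with w hw
      simp only [h1, iff_true, one_ne_zero, iff_false, not_le]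
      exact ⟨by linarith, hw.le⟩
    simp only [h0, h1, iff_false, not_le] at hi ⊢
    have e1 : (1 / 2 + max (ν / ((x, 1) : (Fin m → I) × ℝ).2) 1 *
          ((((x, 1) : (Fin m → I) × ℝ).1 i : ℝ) - 1 / 2)) = 1 / 2 + ν * ((x i : ℝ) - 1 / 2) := by
      simp only [div_one, hm]
    exact (hc.eventually_const_lt (hi.1.trans_eq e1.symm)).and
      (hc.eventually_lt_const (e1.trans_lt hi.2))
  obtain ⟨r, hr, hball⟩ := Metric.eventually_nhds_iff.1 (eventually_all.2 key)
  refine ⟨min r (ν - 1), lt_min hr (by linarith), fun v ν' h1 h2 h3 => ⟨?_, ?_⟩⟩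
  · refine hball (y := (v, ν')) ?_
    rw [Prod.dist_eq, max_lt_iff, Real.dist_eq, abs_lt]
    exact ⟨h1.trans_le (min_le_left _ _), by linarith, by linarith [min_le_left r (ν - 1)]⟩
  · linarith [min_le_right r (ν - 1)]

/-- Directed paths near a path from bottom to top of a cube become, after any proper stretching,
paths in that cube. -/
theorem eventually_runsIn {m : ℕ} {p : C(I, X.Realization)} {d : X.cube m} {a b : I}
    (hab : a ≤ b) (h : RunsIn p d a b 0 1) {μ : ℝ} (hμ : 1 < μ) :
    ∀ᶠ p' in 𝓝 p, IsDPath p' → RunsIn (stretchPath μ p') d a b 0 1 := by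
  obtain ⟨β, hβ, hp, hβa, hβb⟩ := h
  choose ν V hν hνμ hVo hV hνc hpoint hpath using
    fun x => exists_chart d x (sub_pos.2 hμ)
  choose r hr hrc using fun x => SameCarrier.eventually (hν x) (hνc x)
  have hdiv : ∀ x, 1 ≤ μ / ν x := fun x => by
    rw [le_div_iff₀ (by linarith [hν x])]
    linarith [hνμ x]
  have hmul : ∀ x, μ / ν x * ν x = μ := fun x => div_mul_cancel₀ _ (by linarith [hν x])
  -- `E x q y`: the chart at `x` lifts `q`, and stretching the lift by the remaining factor `μ / ν
  -- x` gives `y`. Lifts to `d` are unique only within a chart, since faces of `d` may be identified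
  -- in `X`; so they have to be followed from chart to chart.
  let E : (Fin m → I) → X.Realization → (Fin m → I) → Prop := fun x q y =>
    ∃ v, stretchMap (ν x) q = pt d v ∧ SameCarrier v x ∧ y = stretchVec (μ / ν x) v
  have hE : ∀ {x q y}, E x q y → stretchMap μ q = pt d y := by
    rintro x q y ⟨v, h1, -, rfl⟩
    rw [← stretchMap_pt, ← h1, stretchMap_stretchMap (hdiv x) (hν x).le, hmul]
  let Q : (Fin m → I) → I → (Fin m → I) → I → Prop := fun x s x' s' =>
    ∀ᶠ p' in 𝓝 p, IsDPath p' → ∀ y, E x (p' s) y →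
      ∃ y', E x' (p' s') y' ∧ RunsIn (stretchPath μ p') d s s' y y'
  have Qtrans : ∀ {x s x' s' x'' s''}, s ≤ s' → s' ≤ s'' → Q x s x' s' → Q x' s' x'' s'' →
      Q x s x'' s'' := by
    intro x s x' s' x'' s'' h1 h2 h3 h4
    filter_upwards [h3, h4] with p' h3 h4 hp' y hy
    obtain ⟨y', hy', k1⟩ := h3 hp' y hy
    obtain ⟨y'', hy'', k2⟩ := h4 hp' y' hy'
    exact ⟨y'', hy'', k1.trans h1 h2 k2⟩
  have Qmove : ∀ {x s s'}, s ≤ s' → (∀ τ ∈ Icc s s', p τ ∈ V x) → Q x s x s' := by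
    intro x s s' hss' hm
    filter_upwards [(ContinuousMap.isOpen_setOfPred_mapsTo (isCompact_Icc (a := s) (b := s'))
      (hVo x)).mem_nhds hm] with p' hm' hp' y hy
    obtain ⟨v, hv, hv'⟩ := hpath x p' hp' s s' hss' hm'
    obtain ⟨v₀, h1, h2, rfl⟩ := hy
    have hs := hv' s (left_mem_Icc.2 hss')
    obtain rfl : v₀ = v s := (h2.trans hs.2.symm).eq_of_pt_eq (h1.symm.trans hs.1)
    have hs' := hv' s' (right_mem_Icc.2 hss')
    exact ⟨_, ⟨v s', hs'.1, hs'.2, rfl⟩, _, hv.stretchVec _,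
      fun τ hτ => hE ⟨v τ, (hv' τ hτ).1, (hv' τ hτ).2, rfl⟩, rfl, rfl⟩
  -- A finer chart at `β s`, with factor `κ` so close to `1` that both `ν x / κ` and `ν x' / κ`
  -- remain admissible, refines both charts; hence both yield the same point `y`.
  have Qchange : ∀ {x x' s}, s ∈ Icc a b → dist (β s) x < r x → dist (β s) x' < r x' →
      Q x s x' s := by
    intro x x' s hs hx hx'
    obtain ⟨δ, hδ, h1⟩ : ∃ δ > 0, δ ≤ r x - dist (β s) x ∧ δ ≤ r x' - dist (β s) x' :=
      ⟨min _ _, lt_min (sub_pos.2 hx) (sub_pos.2 hx'), min_le_left _ _, min_le_right _ _⟩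
    obtain ⟨κ, U, hκ, hκδ, hU, hsU, -, hU', -⟩ := exists_chart d (β s) hδ
    rw [← hp s hs] at hsU
    filter_upwards [(ContinuousEvalConst.continuous_eval_const s).continuousAt.eventually_mem
      (hU.mem_nhds hsU)] with p' hp'U hp' y hy
    obtain ⟨w, hw, hw1, -⟩ := hU' _ hp'U
    have key : ∀ {x}, δ ≤ r x - dist (β s) x → stretchMap (ν x) (p' s) =
        pt d (stretchVec (ν x / κ) w) ∧ SameCarrier (stretchVec (ν x / κ) w) x ∧
        stretchVec (μ / κ) w = stretchVec (μ / ν x) (stretchVec (ν x / κ) w) := by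
      intro x hx
      have hκ0 : 0 < κ := by linarith
      have hd0 := dist_nonneg (x := β s) (y := x)
      have hwx : dist w x < r x := by linarith [dist_triangle w (β s) x]
      obtain ⟨k1, k2⟩ := hrc x w κ hwx hκ.le (by linarith)
      have k3 : 1 ≤ ν x / κ := (one_le_div hκ0).2 k2
      have k4 : ν x / κ * κ = ν x := div_mul_cancel₀ _ hκ0.ne'
      refine ⟨?_, k1, ?_⟩
      · rw [← stretchMap_pt, ← hw1, stretchMap_stretchMap k3 hκ.le, k4]
      · rw [stretchVec_stretchVec (hdiv x) k3, ← hmul x, mul_div_assoc, hmul]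
    obtain ⟨v, h2, h3, rfl⟩ := hy
    obtain ⟨k1, k2, k3⟩ := key h1.1
    obtain ⟨k1', k2', k3'⟩ := key h1.2
    obtain rfl := (h3.trans k2.symm).eq_of_pt_eq (h2.symm.trans k1)
    rw [← k3, k3']
    refine ⟨_, ⟨_, k1', k2', rfl⟩, fun _ => _, ⟨continuousOn_const, monotoneOn_const⟩,
      fun τ hτ => ?_, rfl, rfl⟩
    obtain rfl : τ = s := le_antisymm hτ.2 hτ.1
    exact hE ⟨_, k1', k2', rfl⟩
  -- Near a time `u` one passes to the chart at `β u`, moves inside it and changes back;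
  -- connectedness of `[a,b]` globalizes this.
  have Qall : Q (β a) a (β b) b := by
    have := isPreconnected_Icc.induction₂' (s := Icc a b) (fun u w => ∀ s s', s ∈ uIcc u w →
      s' ∈ uIcc u w → s ≤ s' → Q (β s) s (β s') s') ?_ ?_ (left_mem_Icc.2 hab)
      (right_mem_Icc.2 hab)
    · exact this a b left_mem_uIcc right_mem_uIcc hab
    · intro u hu
      have h1 : ∀ᶠ τ in 𝓝[Icc a b] u, p τ ∈ V (β u) ∧ dist (β τ) (β u) < r (β u) := by
        refine ((p.continuous.continuousAt.continuousWithinAt).eventually_mem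
          ((hVo _).mem_nhds (hp u hu ▸ hV (β u)))).and ?_
        exact (hβ.1 u hu).eventually_mem (Metric.ball_mem_nhds _ (hr _))
      rw [eventually_nhdsWithin_iff, Metric.eventually_nhds_iff] at h1
      obtain ⟨ρ, hρ, h1⟩ := h1
      have h2 : ∀ w ∈ Icc a b, dist w u < ρ → ∀ s s', s ∈ uIcc u w → s' ∈ uIcc u w → s ≤ s' →
          Q (β s) s (β s') s' := by
        intro w hw hwu s s' hs hs' hss'
        have hsub : ∀ τ ∈ uIcc u w, τ ∈ Icc a b ∧ p τ ∈ V (β u) ∧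
            dist (β τ) (β u) < r (β u) := by
          intro τ hτ
          have hτ' := ordConnected_Icc.uIcc_subset hu hw hτ
          refine ⟨hτ', h1 ?_ hτ'⟩
          refine lt_of_le_of_lt ?_ hwu
          rw [Subtype.dist_eq, Subtype.dist_eq, Real.dist_eq, Real.dist_eq]
          apply abs_sub_left_of_mem_uIcc
          rw [mem_uIcc] at hτ ⊢
          exact hτ
        have hself : ∀ x, dist x x < r x := fun x => by rw [dist_self]; exact hr x
        refine Qtrans le_rfl hss' (Qchange (hsub s hs).1 (hself _) (hsub s hs).2.2)
          (Qtrans hss' le_rfl (Qmove hss' fun τ hτ => ?_)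
            (Qchange (hsub s' hs').1 (hsub s' hs').2.2 (hself _)))
        exact (hsub τ (ordConnected_uIcc.out hs hs' hτ)).2.1
      filter_upwards [nhdsWithin_le_nhds (Metric.ball_mem_nhds u hρ), self_mem_nhdsWithin]
        with w hw hw'
      exact ⟨h2 w hw' hw, by rw [uIcc_comm]; exact h2 w hw' hw⟩
    · intro u w y hu hw hy h1 h2 s s' hs hs' hss'
      have hcover := uIcc_subset_uIcc_union_uIcc (a := u) (b := w) (c := y)
      rcases hcover hs with h3 | h3 <;> rcases hcover hs' with h4 | h4
      · exact h1 s s' h3 h4 hss'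
      · rcases le_total s w with h5 | h5
        · rcases le_total w s' with h6 | h6
          · exact Qtrans h5 h6 (h1 s w h3 right_mem_uIcc h5) (h2 w s' left_mem_uIcc h4 h6)
          · exact h1 s s' h3 (ordConnected_uIcc.out h3 right_mem_uIcc ⟨hss', h6⟩) hss'
        · exact h2 s s' (ordConnected_uIcc.out left_mem_uIcc h4 ⟨h5, hss'⟩) h4 hss'
      · rcases le_total s w with h5 | h5
        · rcases le_total w s' with h6 | h6
          · exact Qtrans h5 h6 (h2 s w h3 left_mem_uIcc h5) (h1 w s' right_mem_uIcc h4 h6)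
          · exact h2 s s' h3 (ordConnected_uIcc.out h3 left_mem_uIcc ⟨hss', h6⟩) hss'
        · exact h1 s s' (ordConnected_uIcc.out right_mem_uIcc h4 ⟨h5, hss'⟩) h4 hss'
      · exact h2 s s' h3 h4 hss'
  filter_upwards [Qall, (ContinuousEvalConst.continuous_eval_const a).continuousAt.eventually_mem
    ((hVo (β a)).mem_nhds (hp a (left_mem_Icc.2 hab) ▸ hV (β a)))] with p' hQ hVa hp'
  obtain ⟨v, -, h1, h2⟩ := hpoint (β a) (p' a) hVa
  obtain ⟨y', ⟨v', -, h3, rfl⟩, h4⟩ := hQ hp' _ ⟨v, h1, h2, rfl⟩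
  rw [hβa] at h2
  rw [hβb] at h3
  -- The carrier of a corner is that corner alone, so the ends of the lift are exactly the corners.
  obtain rfl : v = 0 := funext fun i => (h2 i).1.2 rfl
  obtain rfl : v' = 1 := funext fun i => (h3 i).2.2 rfl
  rwa [stretchVec_zero, stretchVec_one] at h4

/-! ### Stretching preserves the classes of paths -/

theorem IsDPath.stretchPath {p : C(I, X.Realization)} (h : IsDPath p) (a : ℝ) :
    IsDPath (stretchPath a p) := by
  obtain ⟨l, t, ht, h⟩ := h
  refine ⟨l, t, ht, fun k => ?_⟩
  obtain ⟨n, c, β, h1, h2⟩ := h k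
  exact ⟨n, c, _, h1.stretchVec a, h2.stretchVec a⟩

theorem IsStrict.stretchPath {p : C(I, X.Realization)} (h : IsStrict p) (a : ℝ) :
    IsStrict (stretchPath a p) := by
  obtain ⟨l, t, ht, h⟩ := h
  refine ⟨l, t, ht, fun k => ?_⟩
  obtain ⟨n, c, β, h1, h2⟩ := h k
  refine ⟨n, c, _, ⟨h1.1.stretchVec a, fun i s hs s' hs' heq => ?_⟩, h2.stretchVec a⟩
  by_cases h0 : stretch a (β s i) = 0
  · exact Or.inr (Or.inl h0)
  by_cases h0' : stretch a (β s i) = 1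
  · exact Or.inr (Or.inr h0')
  rcases h1.2 i s hs s' hs' (eq_of_stretch_eq heq h0 h0') with h3 | h3 | h3
  · exact Or.inl h3
  · exact absurd (h3 ▸ stretch_zero a) h0
  · exact absurd (h3 ▸ stretch_one a) h0'

theorem IsTame.stretchPath {p : C(I, X.Realization)} (h : IsTame p) (a : ℝ) :
    IsTame (stretchPath a p) := by
  obtain ⟨l, t, ht, hv, h⟩ := h
  refine ⟨l, t, ht, fun k => ?_, fun k => ?_⟩
  · obtain ⟨v, hv⟩ := hv k
    exact ⟨v, by rw [stretchPath_apply, hv, stretchMap_vpt]⟩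
  · obtain ⟨n, c, β, h1, h2⟩ := h k
    exact ⟨n, c, _, h1.stretchVec a, h2.stretchVec a⟩

theorem stretchVec_mem_faceCollar {k n : ℕ} {φ : Fin n → Bool ⊕ Fin k} {y : Fin n → I}
    (h : y ∈ faceCollar φ) (a : ℝ) : stretchVec a y ∈ faceCollar φ := fun i =>
  ⟨fun hi => (stretch_lt_half_iff a _).2 ((h i).1 hi),
    fun hi => (half_lt_stretch_iff a _).2 ((h i).2 hi)⟩

theorem stretchMap_mem_collar {m : ℕ} {d : X.cube m} {q : X.Realization} (h : q ∈ collar d)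
    (a : ℝ) : stretchMap a q ∈ collar d := by
  obtain ⟨n, k, c, e, φ, ψ, h1, h2, y, hy, rfl⟩ := h
  exact ⟨n, k, c, e, φ, ψ, h1, h2, _, stretchVec_mem_faceCollar hy a, stretchMap_pt a c y⟩

theorem IsShadow.stretchPath {m : ℕ} {p : C(I, X.Realization)} {d : X.cube m} {s s' : I}
    {r : I → Fin m → I} (h : IsShadow p d s s' r) (a : ℝ) :
    IsShadow (stretchPath a p) d s s' (fun τ => stretchVec a (r τ)) := by
  obtain ⟨n, k, c, e, φ, ψ, β, h1, h2, h3, h4, h5⟩ := h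
  refine ⟨n, k, c, e, φ, ψ, _, h1, h2, h3.stretchVec a, h4.stretchVec a, fun τ hτ => ?_⟩
  obtain ⟨h6, z, hz, hr⟩ := h5 τ hτ
  refine ⟨stretchVec_mem_faceCollar h6 a, stretchVec a z, fun i j hij => ?_, ?_⟩
  · simp only [stretchVec, hz i j hij]
  · simp only [hr, stretchVec_faceMap]

theorem RunsThrough.stretchPath {m : ℕ} {p : C(I, X.Realization)} {d : X.cube m} {s s' : I}
    (h : RunsThrough p d s s') (a : ℝ) : RunsThrough (stretchPath a p) d s s' := by
  obtain ⟨l, t, r, h1, h2, h3, h4, h5, h6, h7⟩ := h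
  refine ⟨l, t, fun k τ => stretchVec a (r k τ), h1, h2, h3, fun k => (h4 k).stretchPath a,
    fun k i => ?_, fun i => (stretch_lt_half_iff a _).2 (h6 i),
    fun i => (half_lt_stretch_iff a _).2 (h7 i)⟩
  simpa only [stretchVec, stretch_lt_half_iff, half_lt_stretch_iff] using h5 k i

theorem RunsIn.stretchPath {m : ℕ} {p : C(I, X.Realization)} {d : X.cube m} {s s' : I}
    (h : RunsIn p d s s' 0 1) (a : ℝ) : RunsIn (stretchPath a p) d s s' 0 1 := by
  obtain ⟨β, h1, h2, h3, h4⟩ := h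
  exact ⟨_, h1.stretchVec a, h2.stretchVec a, by rw [h3, stretchVec_zero],
    by rw [h4, stretchVec_one]⟩

theorem stretchPath_mem_strictPaths {x y : X.cube 0} {p : C(I, X.Realization)}
    (h : p ∈ strictPaths x y) (a : ℝ) : stretchPath a p ∈ strictPaths x y :=
  ⟨by rw [stretchPath_apply, h.1, stretchMap_vpt], by rw [stretchPath_apply, h.2.1, stretchMap_vpt],
    h.2.2.stretchPath a⟩

theorem stretchPath_mem_strictTamePaths {x y : X.cube 0} {p : C(I, X.Realization)}
    (h : p ∈ strictTamePaths x y) (a : ℝ) : stretchPath a p ∈ strictTamePaths x y :=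
  ⟨by rw [stretchPath_apply, h.1, stretchMap_vpt], by rw [stretchPath_apply, h.2.1, stretchMap_vpt],
    h.2.2.1.stretchPath a, h.2.2.2.stretchPath a⟩

/-! ### Large stretching moves a path from the collar into the cube -/

/-- Coordinates off the middle are eventually cut off to the same end point and those at `1/2`
already agree: the jumps between consecutive shadows disappear. -/
theorem SameSide.eventually_stretchVec_eq {m : ℕ} {x y : Fin m → I} (h : SameSide x y) :
    ∀ᶠ a in atTop, stretchVec a x = stretchVec a y := by
  have : ∀ i, ∀ᶠ a in atTop, stretch a (x i) = stretch a (y i) := by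
    intro i
    obtain ⟨h1, h2⟩ := h i
    rcases lt_trichotomy (x i : ℝ) (1 / 2) with h3 | h3 | h3
    · filter_upwards [eventually_stretch_eq_zero h3, eventually_stretch_eq_zero (h1.1 h3)]
        with a ha ha'
      rw [ha, ha']
    · have : x i = y i := by
        refine Subtype.ext (le_antisymm (not_lt.1 fun h4 => ?_) (not_lt.1 fun h4 => ?_))
        · exact absurd (h1.2 (h4.trans_eq h3)) h3.not_lt
        · exact absurd (h2.2 (h3.symm.trans_lt h4)) h3.not_gt
      rw [this]
      exact Eventually.of_forall fun _ => rfl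
    · filter_upwards [eventually_stretch_eq_one h3, eventually_stretch_eq_one (h2.1 h3)]
        with a ha ha'
      rw [ha, ha']
  exact (eventually_all.2 this).mono fun a ha => funext ha

/-- By monotonicity a collar coordinate near `0` is largest at `s'` and one near `1` is smallest at
`s`. A factor that collapses them at these times collapses them throughout, and the stretched path
is the stretched shadow. -/
theorem IsShadow.eventually_runsIn {m : ℕ} {p : C(I, X.Realization)} {d : X.cube m} {s s' : I}
    (hss' : s ≤ s') {r : I → Fin m → I} (h : IsShadow p d s s' r) :
    ∀ᶠ a in atTop,
      RunsIn (PrecubicalSet.stretchPath a p) d s s' (stretchVec a (r s)) (stretchVec a (r s')) := by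
  obtain ⟨n, k, c, e, φ, ψ, β, hφ, hψ, hβ, hp, hr⟩ := h
  obtain ⟨f, hf⟩ := hφ.exists_index
  have hs := left_mem_Icc.2 hss'
  have hs' := right_mem_Icc.2 hss'
  have hr' : ∀ τ ∈ Icc s s', r τ = faceMap ψ (fun j => β τ (f j)) := fun τ hτ => by
    obtain ⟨-, z, hz, h1⟩ := hr τ hτ
    rw [h1]
    congr 1
    exact funext fun j => (hz (f j) j ((hf _ _).2 rfl)).symm
  have h0 : ∀ᶠ a in atTop, ∀ i, φ i = Sum.inl false → stretch a (β s' i) = 0 :=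
    eventually_all.2 fun i => eventually_imp_distrib_left.2 fun hi =>
      eventually_stretch_eq_zero (((hr s' hs').1 i).1 hi)
  have h1 : ∀ᶠ a in atTop, ∀ i, φ i = Sum.inl true → stretch a (β s i) = 1 :=
    eventually_all.2 fun i => eventually_imp_distrib_left.2 fun hi =>
      eventually_stretch_eq_one (((hr s hs).1 i).2 hi)
  filter_upwards [h0, h1] with a h0 h1
  refine ⟨fun τ => stretchVec a (faceMap ψ fun j => β τ (f j)), ⟨?_, ?_⟩, fun τ hτ => ?_,
    by rw [hr' s hs], by rw [hr' s' hs']⟩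
  · refine ((continuous_stretchVec a).comp (continuous_faceMap ψ)).comp_continuousOn
      (continuousOn_pi.2 fun j => continuousOn_pi.1 hβ.1 (f j))
  · intro τ hτ τ' hτ' hle
    exact stretchVec_monotone a (faceMap_monotone ψ fun j => hβ.2 hτ hτ' hle (f j))
  · have h2 : stretchVec a (β τ) = faceMap φ (stretchVec a fun j => β τ (f j)) := by
      funext i
      simp only [faceMap, stretchVec]
      cases hi : φ i with
      | inl α =>
        cases α
        · refine le_antisymm ?_ nonneg'
          exact (stretch_monotone a (hβ.2 hτ hs' hτ.2 i)).trans_eq (h0 i hi)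
        · refine le_antisymm le_one' ?_
          exact (h1 i hi).symm.trans_le (stretch_monotone a (hβ.2 hs hτ hτ.1 i))
      | inr j => rw [(hf i j).1 hi, Sum.elim_inr, stretchVec]
    dsimp only
    rw [stretchPath_apply, hp τ hτ, stretchMap_pt, h2, hφ.pt_eq, stretchVec_faceMap, hψ.pt_eq]

theorem RunsThrough.eventually_runsIn {m : ℕ} {p : C(I, X.Realization)} {d : X.cube m} {a b : I}
    (h : RunsThrough p d a b) :
    ∀ᶠ μ in atTop, RunsIn (PrecubicalSet.stretchPath μ p) d a b 0 1 := by
  obtain ⟨l, s, r, hs, rfl, rfl, hsh, hside, h0, h1⟩ := h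
  have e1 := eventually_all.2 fun k =>
    (hsh k).eventually_runsIn (hs (Fin.castSucc_lt_succ).le)
  have e2 := eventually_all.2 fun k => (hside k).eventually_stretchVec_eq
  have e3 : ∀ᶠ μ in atTop, ∀ i, stretch μ (r 0 (s 0) i) = 0 :=
    eventually_all.2 fun i => eventually_stretch_eq_zero (h0 i)
  have e4 : ∀ᶠ μ in atTop, ∀ i, stretch μ (r (Fin.last l) (s (Fin.last (l + 1))) i) = 1 :=
    eventually_all.2 fun i => eventually_stretch_eq_one (h1 i)
  filter_upwards [e1, e2, e3, e4] with μ e1 e2 e3 e4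
  have key : ∀ k : Fin (l + 1), RunsIn (PrecubicalSet.stretchPath μ p) d (s 0) (s k.succ)
      (stretchVec μ (r 0 (s 0))) (stretchVec μ (r k (s k.succ))) := by
    intro k
    induction k using Fin.induction with
    | zero => simpa using e1 0
    | succ k ih =>
      rw [Fin.succ_castSucc, e2 k] at ih
      exact ih.trans (hs (Fin.zero_le _)) (hs Fin.castSucc_lt_succ.le) (e1 k.succ)
  have := key (Fin.last l)
  rw [Fin.succ_last] at this
  rwa [show stretchVec μ (r 0 (s 0)) = 0 from funext e3,
    show stretchVec μ (r (Fin.last l) (s (Fin.last (l + 1)))) = 1 from funext e4] at this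

theorem RunsIn.runsThrough {m : ℕ} {p : C(I, X.Realization)} {d : X.cube m} {a b : I}
    (hab : a ≤ b) (h : RunsIn p d a b 0 1) : RunsThrough p d a b := by
  obtain ⟨β, h1, h2, h3, h4⟩ := h
  refine ⟨0, ![a, b], fun _ => β, ?_, rfl, rfl, fun k => ?_, fun k => k.elim0, ?_, ?_⟩
  · rw [Fin.monotone_iff_le_succ]
    intro i
    obtain rfl : i = 0 := Subsingleton.elim _ _
    exact hab
  · obtain rfl : k = 0 := Subsingleton.elim (α := Fin 1) _ _
    refine ⟨m, m, d, d, Sum.inr, Sum.inr, β, .refl d, .refl d, h1, h2, fun s hs =>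
      ⟨fun i => by simp, β s, fun i j hij => ?_, rfl⟩⟩
    rw [Sum.inr.inj hij]
  · intro i
    simp [h3]
  · intro i
    simp only [h4, Pi.one_apply, Icc.coe_one]
    norm_num

theorem IsStrict.isDPath {p : C(I, X.Realization)} (h : IsStrict p) : IsDPath p := by
  obtain ⟨l, t, ht, h⟩ := h
  refine ⟨l, t, ht, fun k => ?_⟩
  obtain ⟨n, c, β, h1, h2⟩ := h k
  exact ⟨n, c, β, h1.1, h2⟩

theorem pt_mem_collar {m : ℕ} (d : X.cube m) (x : Fin m → I) : pt d x ∈ collar d :=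
  ⟨m, m, d, d, Sum.inr, Sum.inr, .refl d, .refl d, x, fun i => by simp, rfl⟩

/-! ### Stretching and paths subordinate to a chain -/

namespace CubeChain

variable {x y : X.cube 0} (c : CubeChain X x y)

theorem mem_tamePathsIn {p : C(I, X.Realization)} : p ∈ c.tamePathsIn ↔
    ∃ t : Fin (c.n + 1) → I, IsSubdivision t ∧
      ∀ i : Fin c.n, RunsIn p (c.cube i) (t i.castSucc) (t i.succ) 0 1 := Iff.rfl

variable {c}

theorem stretchPath_mem_tamePathsIn {p : C(I, X.Realization)} (h : p ∈ c.tamePathsIn) (a : ℝ) :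
    stretchPath a p ∈ c.tamePathsIn := by
  obtain ⟨t, ht, h⟩ := c.mem_tamePathsIn.1 h
  exact c.mem_tamePathsIn.2 ⟨t, ht, fun i => (h i).stretchPath a⟩

theorem stretchPath_mem_pathsInCollar {p : C(I, X.Realization)} (h : p ∈ c.pathsInCollar) (a : ℝ) :
    stretchPath a p ∈ c.pathsInCollar := by
  obtain ⟨hd, t, ht, h1, h2⟩ := h
  exact ⟨hd.stretchPath a, t, ht, fun i => stretchMap_mem_collar (h1 i) a, fun i =>
    ⟨fun s hs => stretchMap_mem_collar ((h2 i).1 s hs) a, (h2 i).2.stretchPath a⟩⟩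

theorem eventually_mem_tamePathsIn {p : C(I, X.Realization)} (h : p ∈ c.tamePathsIn) {μ : ℝ}
    (hμ : 1 < μ) : ∀ᶠ p' in 𝓝 p, IsDPath p' → stretchPath μ p' ∈ c.tamePathsIn := by
  obtain ⟨t, ht, h⟩ := c.mem_tamePathsIn.1 h
  filter_upwards [eventually_all.2 fun i =>
    PrecubicalSet.eventually_runsIn (ht.1 Fin.castSucc_lt_succ.le) (h i) hμ] with p' h1 hp'
  exact c.mem_tamePathsIn.2 ⟨t, ht, fun i => h1 i hp'⟩

theorem exists_stretchPath_mem_tamePathsIn {p : C(I, X.Realization)} (h : p ∈ c.pathsInCollar) :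
    ∃ μ, 1 ≤ μ ∧ stretchPath μ p ∈ c.tamePathsIn := by
  obtain ⟨-, t, ht, -, h⟩ := h
  obtain ⟨μ, h1, h2⟩ := ((eventually_all.2 fun i => (h i).2.eventually_runsIn).and
    (eventually_ge_atTop 1)).exists
  exact ⟨μ, h2, c.mem_tamePathsIn.2 ⟨t, ht, h1⟩⟩

theorem apply_eq_vertex {p : C(I, X.Realization)} {t : Fin (c.n + 1) → I} (ht : IsSubdivision t)
    (h : ∀ i : Fin c.n, RunsIn p (c.cube i) (t i.castSucc) (t i.succ) 0 1) (i : Fin (c.n + 1)) :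
    p (t i) = vpt (c.vertex i) := by
  have hle : ∀ i : Fin c.n, t i.castSucc ≤ t i.succ := fun i => ht.1 Fin.castSucc_lt_succ.le
  induction i using Fin.lastCases with
  | cast i =>
    obtain ⟨β, -, h2, h3, -⟩ := h i
    rw [h2 _ (left_mem_Icc.2 (hle i)), h3, ← c.source_eq, ← pt_corner]
    rfl
  | last =>
    obtain ⟨m, hm⟩ := Nat.exists_eq_succ_of_ne_zero c.n_pos.ne'
    let i : Fin c.n := ⟨m, by omega⟩
    have hi : Fin.last c.n = i.succ := Fin.ext (by simp [i, hm])
    obtain ⟨β, -, h2, -, h4⟩ := h i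
    rw [hi, h2 _ (right_mem_Icc.2 (hle i)), h4, ← c.target_eq, ← pt_corner]
    rfl

theorem strictTameIn_subset_strictTameInCollar : c.strictTameIn ⊆ c.strictTameInCollar := by
  rintro p ⟨h, h0, h1, hs⟩
  obtain ⟨t, ht, h⟩ := c.mem_tamePathsIn.1 h
  have hv := apply_eq_vertex ht h
  refine ⟨⟨hs.isDPath, t, ht, fun i => ?_, fun i => ⟨fun s hs => ?_, ?_⟩⟩, h0, h1, hs,
    c.n, t, ht, fun i => ⟨_, hv i⟩, fun i => ?_⟩
  · rw [hv i]
    exact pt_mem_collar _ _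
  · obtain ⟨β, -, h2, -, -⟩ := h i
    rw [h2 s hs]
    exact pt_mem_collar _ _
  · exact (h i).runsThrough (ht.1 Fin.castSucc_lt_succ.le)
  · obtain ⟨β, h1, h2, -, -⟩ := h i
    exact ⟨_, _, β, h1, h2⟩

theorem strictTameInCollar_subset_strictInCollar : c.strictTameInCollar ⊆ c.strictInCollar :=
  fun _ h => ⟨h.1, h.2.1, h.2.2.1, h.2.2.2.1⟩

end CubeChain

/-! ### Sums over the coordinates of a point -/

/-- The sum of the values of `f` at the coordinates of a point of `|X|`; it is well defined if `f`
vanishes at `0` and `1`. -/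
def coordSum {M : Type*} [AddCommMonoid M] (f : I → M) (h : ∀ α, f (endpt α) = 0) :
    X.Realization → M :=
  Quot.lift (fun q => ∑ i, f (q.2 i)) (by
    rintro _ _ ⟨c, α, i, x⟩
    simp [Fin.sum_univ_succAbove _ i, h])

theorem coordSum_pt {M : Type*} [AddCommMonoid M] (f : I → M) (h : ∀ α, f (endpt α) = 0)
    {n : ℕ} (c : X.cube n) (x : Fin n → I) : coordSum f h (pt c x) = ∑ i, f (x i) := rfl

open Classical in
/-- The indicator function of the midpoint. -/
noncomputable def atHalf (x : I) : ℕ := if (x : ℝ) = 1 / 2 then 1 else 0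

theorem atHalf_endpt (α : Bool) : atHalf (endpt α) = 0 := by
  cases α <;> norm_num [atHalf, endpt]

/-- The number of coordinates of a point that are equal to `1/2`. -/
noncomputable def numHalves : X.Realization → ℕ := coordSum atHalf atHalf_endpt

theorem numHalves_stretchMap (a : ℝ) (q : X.Realization) :
    numHalves (stretchMap a q) = numHalves q := by
  obtain ⟨n, c, x, rfl⟩ := exists_eq_pt q
  rw [stretchMap_pt, numHalves, coordSum_pt, coordSum_pt]
  simp only [atHalf, stretchVec, stretch_eq_half_iff]

/-- The distance to the nearest end point, negative in the upper half of the
interval and set to `0` at the midpoint. -/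
noncomputable def saw (x : I) : ℝ :=
  if (x : ℝ) < 1 / 2 then x else if 1 / 2 < (x : ℝ) then x - 1 else 0

theorem saw_endpt (α : Bool) : saw (endpt α) = 0 := by
  cases α <;> norm_num [saw, endpt]

theorem saw_of_lt {x : I} (h : (x : ℝ) < 1 / 2) : saw x = x := if_pos h

theorem saw_of_gt {x : I} (h : 1 / 2 < (x : ℝ)) : saw x = x - 1 :=
  (if_neg h.not_gt).trans (if_pos h)

/-- `saw` has slope `1` on each open half of the interval, so for comparable points on the same
sides equality of the sums forces equality of all terms. -/
theorem eq_of_sum_saw_eq {ι : Type*} [Fintype ι] {v w : ι → I} (hvw : v ≤ w)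
    (hside : ∀ a, ((v a : ℝ) < 1 / 2 ∧ (w a : ℝ) < 1 / 2) ∨ (1 / 2 < (v a : ℝ) ∧ 1 / 2 < (w a : ℝ)) ∨
      ((v a : ℝ) = 1 / 2 ∧ (w a : ℝ) = 1 / 2))
    (h : ∑ a, saw (v a) = ∑ a, saw (w a)) : v = w := by
  have hle : ∀ a ∈ Finset.univ, saw (v a) ≤ saw (w a) := by
    intro a _
    have h1 : (v a : ℝ) ≤ w a := hvw a
    rcases hside a with ⟨h2, h3⟩ | ⟨h2, h3⟩ | ⟨h2, h3⟩
    · rwa [saw_of_lt h2, saw_of_lt h3]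
    · rw [saw_of_gt h2, saw_of_gt h3]
      linarith
    · simp [saw, h2, h3]
  rw [Finset.sum_eq_sum_iff_of_le hle] at h
  funext a
  have h1 := h a (Finset.mem_univ a)
  refine Subtype.ext ?_
  rcases hside a with ⟨h2, h3⟩ | ⟨h2, h3⟩ | ⟨h2, h3⟩
  · rwa [saw_of_lt h2, saw_of_lt h3] at h1
  · rw [saw_of_gt h2, saw_of_gt h3] at h1
    linarith
  · rw [h2, h3]

/-- Each coordinate of each piece of a strict presentation takes the value `1/2` at most once. -/
theorem IsStrict.finite_numHalves {p : C(I, X.Realization)} (h : IsStrict p) :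
    {s | numHalves (p s) ≠ 0}.Finite := by
  obtain ⟨l, t, ht, h⟩ := h
  have key : ∀ k : Fin l, {s | s ∈ Icc (t k.castSucc) (t k.succ) ∧ numHalves (p s) ≠ 0}.Finite := by
    intro k
    obtain ⟨n, c, β, h1, h2⟩ := h k
    refine (finite_iUnion fun i : Fin n => Set.Subsingleton.finite
      (s := {s | s ∈ Icc (t k.castSucc) (t k.succ) ∧ (β s i : ℝ) = 1 / 2}) ?_).subset ?_
    · rintro s ⟨hs, hs1⟩ s' ⟨hs', hs1'⟩
      rcases h1.2 i s hs s' hs' (Subtype.ext (hs1.trans hs1'.symm)) with h3 | h3 | h3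
      · exact h3
      · norm_num [h3] at hs1
      · norm_num [h3] at hs1
    · rintro s ⟨hs, h3⟩
      rw [h2 s hs, numHalves, coordSum_pt] at h3
      obtain ⟨i, -, hi⟩ := Finset.exists_ne_zero_of_sum_ne_zero h3
      refine mem_iUnion.2 ⟨i, hs, ?_⟩
      by_contra h4
      exact hi (if_neg h4)
  refine (finite_iUnion key).subset fun s hs => ?_
  obtain ⟨k, hk⟩ := ht.exists_mem_Icc s
  exact mem_iUnion.2 ⟨k, hk, hs⟩

namespace CubeChain

variable {x y : X.cube 0} (c : CubeChain X x y)

/-! ### Lifting paths to the product of the cubes of a chain -/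

/-- The coordinates of all cubes of the chain. -/
abbrev Coord : Type := Σ i : Fin c.n, Fin (c.dim i)

/-- `w` is a point of the wedge of the cubes of the chain, embedded in their product, that
represents `q ∈ |X|`. -/
def Represents (w : c.Coord → I) (q : X.Realization) : Prop :=
  ∃ i, (∀ a : c.Coord, a.1 < i → w a = 1) ∧ (∀ a : c.Coord, i < a.1 → w a = 0) ∧
    q = pt (c.cube i) (fun j => w ⟨i, j⟩)

variable {c}

/-- Only one cube contributes, all other coordinates being end points. Hence such sums depend on the
represented point alone, not on the chosen lift. -/
theorem Represents.coordSum_eq {M : Type*} [AddCommMonoid M] (f : I → M)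
    (h : ∀ α, f (endpt α) = 0) {w : c.Coord → I} {q : X.Realization} (hw : c.Represents w q) :
    coordSum f h q = ∑ a, f (w a) := by
  obtain ⟨i, h1, h2, rfl⟩ := hw
  rw [coordSum_pt, Fintype.sum_sigma, Finset.sum_eq_single i]
  · intro i' _ hne
    refine Finset.sum_eq_zero fun j _ => ?_
    rcases hne.lt_or_gt with h3 | h3
    · rw [h1 ⟨i', j⟩ h3]
      exact h true
    · rw [h2 ⟨i', j⟩ h3]
      exact h false
  · exact fun h => absurd (Finset.mem_univ i) h

theorem isClosed_represents :
    IsClosed {r : (c.Coord → I) × X.Realization | c.Represents r.1 r.2} := by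
  have : {r : (c.Coord → I) × X.Realization | c.Represents r.1 r.2} =
      ⋃ i, ((⋂ a : c.Coord, ⋂ _ : a.1 < i, {r | r.1 a = 1}) ∩
        ((⋂ a : c.Coord, ⋂ _ : i < a.1, {r | r.1 a = 0}) ∩
        {r | r.2 = pt (c.cube i) (fun j => r.1 ⟨i, j⟩)})) := by
    ext r
    simp [Represents]
  rw [this]
  refine isClosed_iUnion_of_finite fun i => ?_
  have hc : ∀ a : c.Coord, Continuous fun r : (c.Coord → I) × X.Realization => r.1 a :=
    fun a => (continuous_apply a).comp continuous_fst
  refine (isClosed_iInter fun a => isClosed_iInter fun _ =>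
    isClosed_eq (hc a) continuous_const).inter ((isClosed_iInter fun a => isClosed_iInter fun _ =>
    isClosed_eq (hc a) continuous_const).inter (isClosed_eq continuous_snd ?_))
  exact (continuous_pt _).comp (continuous_pi fun j => hc ⟨i, j⟩)

/-- Each piece is extended by `0` before its interval and by `1` after it. -/
theorem exists_lift {p : C(I, X.Realization)} (h : p ∈ c.tamePathsIn) :
    ∃ (t : Fin (c.n + 1) → I) (B : I → c.Coord → I), IsSubdivision t ∧ Continuous B ∧ Monotone B ∧
      B 0 = 0 ∧ B 1 = 1 ∧ (∀ s, c.Represents (B s) (p s)) ∧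
      (∀ a s, s ≤ t a.1.castSucc → B s a = 0) ∧ (∀ a s, t a.1.succ ≤ s → B s a = 1) ∧
      ∀ i, ∀ s ∈ Icc (t i.castSucc) (t i.succ), p s = pt (c.cube i) (fun j => B s ⟨i, j⟩) := by
  obtain ⟨t, ht, h⟩ := c.mem_tamePathsIn.1 h
  have hle : ∀ i : Fin c.n, t i.castSucc ≤ t i.succ := fun i => ht.1 Fin.castSucc_lt_succ.le
  choose β hβ hp hβ0 hβ1 using h
  let B : I → c.Coord → I := fun s a =>
    β a.1 (projIcc (t a.1.castSucc) (t a.1.succ) (hle a.1) s : Icc _ _) a.2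
  have hB0 : ∀ a s, s ≤ t a.1.castSucc → B s a = 0 := fun a s hs => by
    simp only [B, projIcc_of_le_left (hle a.1) hs, hβ0, Pi.zero_apply]
  have hB1 : ∀ a s, t a.1.succ ≤ s → B s a = 1 := fun a s hs => by
    simp only [B, projIcc_of_right_le (hle a.1) hs, hβ1, Pi.one_apply]
  have hBp : ∀ i, ∀ s ∈ Icc (t i.castSucc) (t i.succ),
      p s = pt (c.cube i) (fun j => B s ⟨i, j⟩) := fun i s hs => by
    simp only [B, projIcc_of_mem (hle i) hs]
    exact hp i s hs
  refine ⟨t, B, ht, ?_, ?_, ?_, ?_, fun s => ?_, hB0, hB1, hBp⟩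
  · refine continuous_pi fun a => ?_
    exact (continuousOn_pi.1 (hβ a.1).1 a.2).comp_continuous
      (continuous_subtype_val.comp continuous_projIcc) fun s => Subtype.coe_prop _
  · intro s s' hss' a
    exact (hβ a.1).2 (Subtype.coe_prop _) (Subtype.coe_prop _) (monotone_projIcc _ hss') a.2
  · exact funext fun a => hB0 a 0 nonneg'
  · exact funext fun a => hB1 a 1 le_one'
  · obtain ⟨i, hi⟩ := ht.exists_mem_Icc s
    refine ⟨i, fun a ha => hB1 a s ?_, fun a ha => hB0 a s ?_, hBp i s hi⟩
    · exact (ht.1 (by simpa [Fin.le_def] using ha)).trans hi.1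
    · exact hi.2.trans (ht.1 (by simpa [Fin.le_def] using ha))

/-! ### Continuity of monotone lifts by counting midpoints -/

section Count

variable {p : C(I, X.Realization)} {B : I → c.Coord → I}

/-- A monotone coordinate equal to `1/2` at two times is so on the whole interval between them,
which is infinite. -/
theorem eq_of_apply_eq_half (hfin : {s | numHalves (p s) ≠ 0}.Finite) (hB : Monotone B)
    (hp : ∀ s, c.Represents (B s) (p s)) {a : c.Coord} {s s' : I} (h : (B s a : ℝ) = 1 / 2)
    (h' : (B s' a : ℝ) = 1 / 2) : s = s' := by
  wlog hlt : s < s' generalizing s s'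
  · by_contra hne
    exact hne (this h' h ((Ne.symm hne).lt_of_le (not_lt.1 hlt))).symm
  exfalso
  refine (Icc_infinite hlt) (hfin.subset fun τ hτ => ?_)
  have h1 : (B τ a : ℝ) = 1 / 2 :=
    le_antisymm (h' ▸ (hB hτ.2 a : (B τ a : ℝ) ≤ B s' a)) (h ▸ (hB hτ.1 a : (B s a : ℝ) ≤ B τ a))
  show numHalves (p τ) ≠ 0
  rw [numHalves, (hp τ).coordSum_eq]
  exact (Finset.sum_pos' (fun _ _ => Nat.zero_le _)
    ⟨a, Finset.mem_univ a, by simp [atHalf, h1]⟩).ne'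

/-- If a stretching of `p` is subordinate to the chain, then every coordinate of a monotone lift of
`p` attains the value `1/2`. -/
theorem exists_apply_eq_half (hfin : {s | numHalves (p s) ≠ 0}.Finite) (hB : Monotone B)
    (hp : ∀ s, c.Represents (B s) (p s)) {μ : ℝ} (hμ : stretchPath μ p ∈ c.tamePathsIn)
    (a : c.Coord) : ∃ s, (B s a : ℝ) = 1 / 2 := by
  obtain ⟨-, B', -, hB'c, hB', hB'0, hB'1, hp', -⟩ := exists_lift hμ
  by_contra! hcon
  have hT : ∀ s, s ∉ hfin.toFinset → numHalves (p s) = 0 := fun s hs => by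
    simpa using hs
  -- Double counting: at each time both lifts have as many coordinates equal to `1/2` as the point
  -- of `|X|`. Per coordinate this happens at least once for the continuous `B'` and at most once
  -- for `B`, hence exactly once for both.
  have hsum : ∑ a : c.Coord, ∑ s ∈ hfin.toFinset, atHalf (B' s a) =
      ∑ a : c.Coord, ∑ s ∈ hfin.toFinset, atHalf (B s a) := by
    rw [Finset.sum_comm, Finset.sum_comm (f := fun a s => atHalf (B s a))]
    refine Finset.sum_congr rfl fun s _ => ?_
    rw [← (hp s).coordSum_eq atHalf atHalf_endpt, ← (hp' s).coordSum_eq atHalf atHalf_endpt]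
    exact numHalves_stretchMap μ (p s)
  have hlow : ∀ a : c.Coord, 1 ≤ ∑ s ∈ hfin.toFinset, atHalf (B' s a) := by
    intro a
    have hc : Continuous fun s => B' s a := (continuous_apply a).comp hB'c
    obtain ⟨s, -, hs⟩ := intermediate_value_Icc (nonneg' : (0 : I) ≤ 1) hc.continuousOn
      (show (⟨1 / 2, by norm_num, by norm_num⟩ : I) ∈ Icc (B' 0 a) (B' 1 a) by
        rw [hB'0, hB'1]; exact ⟨nonneg', le_one'⟩)
    have h1 : atHalf (B' s a) = 1 := by
      have : B' s a = _ := hs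
      simp [atHalf, this]
    have h2 : s ∈ hfin.toFinset := by
      by_contra h3
      have h4 := hT s h3
      rw [← numHalves_stretchMap μ, ← stretchPath_apply, numHalves, (hp' s).coordSum_eq,
        Finset.sum_eq_zero_iff] at h4
      rw [h4 a (Finset.mem_univ a)] at h1
      exact zero_ne_one h1
    exact h1.symm.trans_le (Finset.single_le_sum (f := fun s => atHalf (B' s a))
      (fun _ _ => Nat.zero_le _) h2)
  have hup : ∀ a : c.Coord, ∑ s ∈ hfin.toFinset, atHalf (B s a) ≤ 1 := by
    intro a
    simp only [atHalf, Finset.sum_boole, Nat.cast_id]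
    rw [Finset.card_le_one]
    intro s hs s' hs'
    exact eq_of_apply_eq_half hfin hB hp (Finset.mem_filter.1 hs).2 (Finset.mem_filter.1 hs').2
  have hlt : ∑ a : c.Coord, ∑ s ∈ hfin.toFinset, atHalf (B s a) <
      ∑ a : c.Coord, ∑ s ∈ hfin.toFinset, atHalf (B' s a) := by
    refine Finset.sum_lt_sum (fun a _ => (hup a).trans (hlow a)) ⟨a, Finset.mem_univ a, ?_⟩
    refine lt_of_eq_of_lt (Finset.sum_eq_zero fun s _ => if_neg (hcon s)) (hlow a)
  exact hlt.ne hsum.symm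

/-- A limit point `w` of `B` at `s` represents `p s`, as `B s` does. A coordinate whose unique
passage through `1/2` is not at `s` lies on the same side in `w` and in `B s`; for the others the
equal counts of midpoints force `1/2` in `w` too. Then the `saw` sums give `w = B s`. -/
theorem continuous_of_monotone_lift (hfin : {s | numHalves (p s) ≠ 0}.Finite) (hB : Monotone B)
    (hp : ∀ s, c.Represents (B s) (p s)) {μ : ℝ} (hμ : stretchPath μ p ∈ c.tamePathsIn) :
    Continuous B := by
  rw [continuous_iff_ultrafilter]
  intro s g hg
  obtain ⟨w, hw⟩ : ∃ w, Tendsto B g (𝓝 w) := ⟨_, (g.map B).le_nhds_lim⟩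
  suffices w = B s from this ▸ hw
  have hwa : ∀ a, Tendsto (fun τ => B τ a) g (𝓝 (w a)) := tendsto_pi_nhds.1 hw
  have hrep : c.Represents w (p s) :=
    isClosed_represents.mem_of_tendsto (hw.prodMk_nhds ((p.continuous.tendsto s).mono_left hg))
      (Eventually.of_forall hp)
  have hside : ∀ a, ((w a : ℝ) < 1 / 2 ∧ (B s a : ℝ) < 1 / 2) ∨
      (1 / 2 < (w a : ℝ) ∧ 1 / 2 < (B s a : ℝ)) ∨ (B s a : ℝ) = 1 / 2 := by
    intro a
    obtain ⟨τ, hτ⟩ := exists_apply_eq_half hfin hB hp hμ a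
    have hne : ∀ s, s ≠ τ → (B s a : ℝ) ≠ 1 / 2 := fun s hs h =>
      hs (eq_of_apply_eq_half hfin hB hp h hτ)
    rcases lt_trichotomy s τ with h1 | h1 | h1
    · left
      obtain ⟨s', h2, h3⟩ := exists_between h1
      have h4 : (B s' a : ℝ) < 1 / 2 :=
        lt_of_le_of_ne (hτ ▸ (hB h3.le a : (B s' a : ℝ) ≤ B τ a)) (hne _ h3.ne)
      have h5 : w a ≤ B s' a := le_of_tendsto (hwa a)
        (mem_of_superset (hg (Iio_mem_nhds h2)) fun _ h => hB (le_of_lt h) a)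
      exact ⟨lt_of_le_of_lt h5 h4, lt_of_le_of_lt (hB h2.le a) h4⟩
    · exact Or.inr (Or.inr (h1 ▸ hτ))
    · right; left
      obtain ⟨s', h2, h3⟩ := exists_between h1
      have h4 : 1 / 2 < (B s' a : ℝ) :=
        lt_of_le_of_ne (hτ ▸ (hB h2.le a : (B τ a : ℝ) ≤ B s' a)) (hne _ h2.ne').symm
      have h5 : B s' a ≤ w a := ge_of_tendsto (hwa a)
        (mem_of_superset (hg (Ioi_mem_nhds h3)) fun _ h => hB (le_of_lt h) a)
      exact ⟨lt_of_lt_of_le h4 h5, lt_of_lt_of_le h4 (hB h3.le a)⟩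
  have hhalf : ∀ a, (B s a : ℝ) = 1 / 2 → (w a : ℝ) = 1 / 2 := by
    have hle : ∀ a ∈ Finset.univ, atHalf (w a) ≤ atHalf (B s a) := by
      intro a _
      rcases hside a with h1 | h1 | h1
      · exact (if_neg h1.1.ne).trans_le (Nat.zero_le _)
      · exact (if_neg h1.1.ne').trans_le (Nat.zero_le _)
      · simp only [atHalf, h1, if_true]
        split_ifs <;> simp
    have heq := (Finset.sum_eq_sum_iff_of_le hle).1
      ((hrep.coordSum_eq atHalf atHalf_endpt).symm.trans
        ((hp s).coordSum_eq atHalf atHalf_endpt))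
    intro a ha
    have := heq a (Finset.mem_univ a)
    by_contra hne
    rw [atHalf, atHalf, if_pos ha, if_neg hne] at this
    exact zero_ne_one this
  have hsaw : ∑ a, saw (w a) = ∑ a, saw (B s a) :=
    (hrep.coordSum_eq saw saw_endpt).symm.trans ((hp s).coordSum_eq saw saw_endpt)
  -- An ultrafilter lives on one side of `s`, so monotonicity makes `w` and `B s` comparable.
  rcases em (Iic s ∈ g) with h1 | h1
  · refine eq_of_sum_saw_eq (fun a => le_of_tendsto (hwa a) (mem_of_superset h1 fun _ h => hB h a))
      (fun a => ?_) hsaw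
    rcases hside a with h2 | h2 | h2
    · exact Or.inl h2
    · exact Or.inr (Or.inl h2)
    · exact Or.inr (Or.inr ⟨hhalf a h2, h2⟩)
  · have h1' : Ioi s ∈ g := by
      rw [← compl_Iic]
      exact Ultrafilter.compl_mem_iff_notMem.2 h1
    refine (eq_of_sum_saw_eq (fun a => ge_of_tendsto (hwa a)
      (mem_of_superset h1' fun _ h => hB (le_of_lt h) a)) (fun a => ?_) hsaw.symm).symm
    rcases hside a with h2 | h2 | h2
    · exact Or.inl h2.symm
    · exact Or.inr (Or.inl h2.symm)
    · exact Or.inr (Or.inr ⟨h2, hhalf a h2⟩)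

end Count

/-- The paths subordinate to a chain are relatively closed in the strict paths that become
subordinate to the chain by stretching. -/
theorem mem_tamePathsIn_of_mem_closure {p : C(I, X.Realization)}
    (hp : p ∈ closure c.tamePathsIn) (hs : IsStrict p) {μ : ℝ}
    (hμ : stretchPath μ p ∈ c.tamePathsIn) : p ∈ c.tamePathsIn := by
  obtain ⟨g, hmem, hg⟩ := mem_closure_iff_ultrafilter.1 hp
  choose! t' B' ht' _ hB' hB'0 hB'1 hrep' hlo' hhi' hpt' using
    fun (p : C(I, X.Realization)) (h : p ∈ c.tamePathsIn) => exists_lift h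
  -- Subdivisions and lifts range over products of copies of `I`, so both converge along the
  -- ultrafilter; the lifts converge only pointwise in time.
  obtain ⟨t, htt⟩ : ∃ t, Tendsto t' g (𝓝 t) := ⟨_, (g.map t').le_nhds_lim⟩
  obtain ⟨B, hBB⟩ : ∃ B, Tendsto B' g (𝓝 B) := ⟨_, (g.map B').le_nhds_lim⟩
  have htt' : ∀ k, Tendsto (fun q => t' q k) g (𝓝 (t k)) := tendsto_pi_nhds.1 htt
  have hBs : ∀ s, Tendsto (fun q => B' q s) g (𝓝 (B s)) := tendsto_pi_nhds.1 hBB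
  have hBa : ∀ s a, Tendsto (fun q => B' q s a) g (𝓝 (B s a)) :=
    fun s => tendsto_pi_nhds.1 (hBs s)
  have hps : ∀ s, Tendsto (fun q : C(I, X.Realization) => q s) g (𝓝 (p s)) := fun s =>
    ((ContinuousEvalConst.continuous_eval_const s).tendsto p).mono_left hg
  have hev : ∀ᶠ q in g, q ∈ c.tamePathsIn := hmem
  have ht : IsSubdivision t := by
    refine ⟨fun k k' hkk' => ?_, ?_, ?_⟩
    · exact le_of_tendsto_of_tendsto (htt' k) (htt' k') (hev.mono fun q hq => (ht' q hq).1 hkk')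
    · exact tendsto_nhds_unique (htt' 0)
        (tendsto_const_nhds.congr' (hev.mono fun q hq => (ht' q hq).2.1.symm))
    · exact tendsto_nhds_unique (htt' _)
        (tendsto_const_nhds.congr' (hev.mono fun q hq => (ht' q hq).2.2.symm))
  have hB : Monotone B := fun s s' hss' a =>
    le_of_tendsto_of_tendsto (hBa s a) (hBa s' a) (hev.mono fun q hq => hB' q hq hss' a)
  have hB0 : B 0 = 0 := tendsto_nhds_unique (hBs 0)
    (tendsto_const_nhds.congr' (hev.mono fun q hq => (hB'0 q hq).symm))
  have hB1 : B 1 = 1 := tendsto_nhds_unique (hBs 1)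
    (tendsto_const_nhds.congr' (hev.mono fun q hq => (hB'1 q hq).symm))
  have hrep : ∀ s, c.Represents (B s) (p s) := fun s =>
    isClosed_represents.mem_of_tendsto ((hBs s).prodMk_nhds (hps s))
      (hev.mono fun q hq => hrep' q hq s)
  -- The subdivision times move with the paths, so the limit inherits these properties only at
  -- strict inequalities; the boundary times follow once `B` is continuous.
  have hlo : ∀ a s, s < t a.1.castSucc → B s a = 0 := fun a s hs =>
    tendsto_nhds_unique (hBa s a) (tendsto_const_nhds.congr' ((hev.and
      ((htt' a.1.castSucc).eventually_const_lt hs)).mono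
        fun q hq => (hlo' q hq.1 a s hq.2.le).symm))
  have hhi : ∀ a s, t a.1.succ < s → B s a = 1 := fun a s hs =>
    tendsto_nhds_unique (hBa s a) (tendsto_const_nhds.congr' ((hev.and
      ((htt' a.1.succ).eventually_lt_const hs)).mono
        fun q hq => (hhi' q hq.1 a s hq.2.le).symm))
  have hpt : ∀ i, ∀ s ∈ Ioo (t i.castSucc) (t i.succ),
      p s = pt (c.cube i) (fun j => B s ⟨i, j⟩) := fun i s hs => by
    have h1 : Tendsto (fun q => pt (c.cube i) (fun j => B' q s ⟨i, j⟩)) g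
        (𝓝 (pt (c.cube i) (fun j => B s ⟨i, j⟩))) :=
      ((continuous_pt (c.cube i)).tendsto _).comp
        (tendsto_pi_nhds.2 fun j => hBa s ⟨i, j⟩)
    refine tendsto_nhds_unique (hps s) (h1.congr' ?_)
    filter_upwards [hev, (htt' i.castSucc).eventually_lt_const hs.1,
      (htt' i.succ).eventually_const_lt hs.2] with q hq h2 h3
    exact (hpt' q hq i s ⟨h2.le, h3.le⟩).symm
  have hBc : Continuous B := continuous_of_monotone_lift hs.finite_numHalves hB hrep hμ
  have hBca : ∀ a, Continuous fun s => B s a := fun a => (continuous_apply a).comp hBc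
  -- A coordinate of the positive-dimensional cube `c.cube i` takes two distinct values in the open
  -- unit interval, and can do so only between these two times. So the closed interval is the
  -- closure of the open one.
  have hlt : ∀ i : Fin c.n, t i.castSucc < t i.succ := by
    intro i
    let a : c.Coord := ⟨i, ⟨0, c.dim_pos i⟩⟩
    have hval : ∀ r : I, r ≠ 0 → r ≠ 1 → ∃ s ∈ Icc (t i.castSucc) (t i.succ), B s a = r := by
      intro r h0 h1
      obtain ⟨s, -, hs⟩ := intermediate_value_Icc (nonneg' : (0 : I) ≤ 1) (hBca a).continuousOn
        (show r ∈ Icc (B 0 a) (B 1 a) by rw [hB0, hB1]; exact ⟨nonneg', le_one'⟩)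
      have hs : B s a = r := hs
      refine ⟨s, ⟨not_lt.1 fun h => h0 ?_, not_lt.1 fun h => h1 ?_⟩, hs⟩
      · rw [← hs, hlo a s h]
      · rw [← hs, hhi a s h]
    obtain ⟨r, hr0, hr1⟩ := exists_between (zero_lt_one : (0 : I) < 1)
    obtain ⟨r', hr'0, hr'1⟩ := exists_between hr1
    obtain ⟨s, hs, hsr⟩ := hval r hr0.ne' hr1.ne
    obtain ⟨s', hs', hsr'⟩ := hval r' (hr0.trans hr'0).ne' hr'1.ne
    have hss' : s < s' := by
      by_contra! h
      exact absurd (hB h a) (not_le.2 (by rw [hsr, hsr']; exact hr'0))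
    exact hs.1.trans_lt (hss'.trans_le hs'.2)
  refine c.mem_tamePathsIn.2 ⟨t, ht, fun i => ⟨fun s j => B s ⟨i, j⟩, ⟨?_, ?_⟩, ?_, ?_, ?_⟩⟩
  · exact (continuous_pi fun j => hBca ⟨i, j⟩).continuousOn
  · exact fun s _ s' _ hss' j => hB hss' ⟨i, j⟩
  · have hcl : IsClosed {s | p s = pt (c.cube i) (fun j => B s ⟨i, j⟩)} :=
      isClosed_eq p.continuous ((continuous_pt _).comp (continuous_pi fun j => hBca ⟨i, j⟩))
    have := closure_minimal (fun s hs => hpt i s hs) hcl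
    rw [closure_Ioo (hlt i).ne] at this
    exact this
  · funext j
    -- At time `0` there are no earlier times to approximate from, but `B 0 = 0` is known.
    rcases eq_or_ne (t i.castSucc) 0 with h0 | h0
    · dsimp only
      rw [h0, hB0]
      rfl
    · have hcl : IsClosed {s | B s ⟨i, j⟩ = 0} := isClosed_eq (hBca ⟨i, j⟩) continuous_const
      have := closure_minimal (s := Iio (t i.castSucc)) (fun s hs => hlo ⟨i, j⟩ s hs) hcl
      rw [closure_Iio' ⟨0, lt_of_le_of_ne nonneg' h0.symm⟩] at this
      exact this self_mem_Iic
  · funext j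
    rcases eq_or_ne (t i.succ) 1 with h0 | h0
    · dsimp only
      rw [h0, hB1]
      rfl
    · have hcl : IsClosed {s | B s ⟨i, j⟩ = 1} := isClosed_eq (hBca ⟨i, j⟩) continuous_const
      have := closure_minimal (s := Ioi (t i.succ)) (fun s hs => hhi ⟨i, j⟩ s hs) hcl
      rw [closure_Ioi' ⟨1, lt_of_le_of_ne le_one' h0⟩] at this
      exact this self_mem_Ici

end CubeChain

namespace CubeChain

variable {x y : X.cube 0} {c : CubeChain X x y}

/-! ### The deformation -/

theorem stretchPath_mem_strictInCollar {p : C(I, X.Realization)} (h : p ∈ c.strictInCollar)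
    (a : ℝ) : stretchPath a p ∈ c.strictInCollar :=
  ⟨stretchPath_mem_pathsInCollar h.1 a, stretchPath_mem_strictPaths h.2 a⟩

theorem stretchPath_mem_strictTameInCollar {p : C(I, X.Realization)}
    (h : p ∈ c.strictTameInCollar) (a : ℝ) : stretchPath a p ∈ c.strictTameInCollar :=
  ⟨stretchPath_mem_pathsInCollar h.1 a, stretchPath_mem_strictTamePaths h.2 a⟩

theorem mem_tamePathsIn_of_mem_closure_of_mem_strictInCollar {p : C(I, X.Realization)}
    (h : p ∈ closure c.tamePathsIn) (hp : p ∈ c.strictInCollar) : p ∈ c.tamePathsIn := by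
  obtain ⟨μ, -, hμ⟩ := exists_stretchPath_mem_tamePathsIn hp.1
  exact mem_tamePathsIn_of_mem_closure h hp.2.2.2 hμ

variable (c) in
/-- The least factor by which a path has to be stretched to become subordinate to the chain. -/
noncomputable def stretchFactor (p : C(I, X.Realization)) : ℝ :=
  sInf {μ | 1 ≤ μ ∧ stretchPath μ p ∈ c.tamePathsIn}

theorem stretchFactor_le {p : C(I, X.Realization)} {μ : ℝ} (h1 : 1 ≤ μ)
    (h : stretchPath μ p ∈ c.tamePathsIn) : c.stretchFactor p ≤ μ :=
  csInf_le ⟨1, fun _ h => h.1⟩ ⟨h1, h⟩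

theorem one_le_stretchFactor {p : C(I, X.Realization)} (hp : p ∈ c.strictInCollar) :
    1 ≤ c.stretchFactor p := by
  obtain ⟨μ, h1, hμ⟩ := exists_stretchPath_mem_tamePathsIn hp.1
  exact le_csInf ⟨μ, h1, hμ⟩ fun _ h => h.1

/-- The infimum is a limit of admissible factors, and the subordinate paths are closed relative to
the strict paths in the collar. -/
theorem stretchPath_stretchFactor_mem {p : C(I, X.Realization)} (hp : p ∈ c.strictInCollar) :
    stretchPath (c.stretchFactor p) p ∈ c.tamePathsIn := by
  obtain ⟨μ, h1, hμ⟩ := exists_stretchPath_mem_tamePathsIn hp.1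
  refine mem_tamePathsIn_of_mem_closure_of_mem_strictInCollar ?_
    (stretchPath_mem_strictInCollar hp _)
  have hcont : Continuous fun a : ℝ => stretchPath a p :=
    continuous_stretchPath.comp (Continuous.prodMk_left p)
  exact map_mem_closure (f := fun a : ℝ => stretchPath a p) hcont
    (csInf_mem_closure (s := {μ | 1 ≤ μ ∧ stretchPath μ p ∈ c.tamePathsIn}) ⟨μ, h1, hμ⟩
      ⟨1, fun _ h => h.1⟩) fun _ h => h.2

theorem stretchPath_mem_of_stretchFactor_le {p : C(I, X.Realization)} (hp : p ∈ c.strictInCollar)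
    {μ : ℝ} (h : c.stretchFactor p ≤ μ) : stretchPath μ p ∈ c.tamePathsIn := by
  have h1 := one_le_stretchFactor hp
  have h2 := stretchPath_mem_tamePathsIn (stretchPath_stretchFactor_mem hp)
    (μ / c.stretchFactor p)
  rwa [stretchPath_stretchPath ((one_le_div (by linarith)).2 h) h1,
    div_mul_cancel₀ _ (by linarith)] at h2

theorem stretchFactor_eq_one {p : C(I, X.Realization)} (hp : p ∈ c.strictInCollar)
    (h : p ∈ c.tamePathsIn) : c.stretchFactor p = 1 :=
  le_antisymm (stretchFactor_le le_rfl (by rwa [stretchPath_one])) (one_le_stretchFactor hp)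

/-- A factor below the infimum leaves the stretched path outside the closed set `closure
c.tamePathsIn`, so it stays too small nearby. A factor `b` above it exceeds it by the proper
stretching `b / c.stretchFactor p`, which makes nearby paths subordinate. -/
theorem continuousOn_stretchFactor : ContinuousOn c.stretchFactor c.strictInCollar := by
  have hcont : ∀ a : ℝ, Continuous fun p : C(I, X.Realization) => stretchPath a p := fun a =>
    continuous_stretchPath.comp (Continuous.prodMk_right a)
  intro p hp
  refine tendsto_order.2 ⟨fun a ha => ?_, fun a ha => ?_⟩
  · rcases lt_or_ge a 1 with h1 | h1
    · filter_upwards [self_mem_nhdsWithin] with q hq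
      exact h1.trans_le (one_le_stretchFactor hq)
    · have h2 : stretchPath a p ∉ closure c.tamePathsIn := fun h3 =>
        not_le.2 ha (stretchFactor_le h1 (mem_tamePathsIn_of_mem_closure_of_mem_strictInCollar h3
          (stretchPath_mem_strictInCollar hp a)))
      filter_upwards [self_mem_nhdsWithin, nhdsWithin_le_nhds ((hcont a).continuousAt.eventually_mem
        (isClosed_closure.isOpen_compl.mem_nhds h2))] with q hq hq'
      by_contra! h3
      exact hq' (subset_closure (stretchPath_mem_of_stretchFactor_le hq h3))
  · obtain ⟨b, hb, hba⟩ := exists_between ha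
    have h1 := one_le_stretchFactor hp
    have h0 : 0 < c.stretchFactor p := by linarith
    have hb1 : 1 < b / c.stretchFactor p := (one_lt_div h0).2 hb
    filter_upwards [self_mem_nhdsWithin, nhdsWithin_le_nhds
      ((hcont (c.stretchFactor p)).continuousAt.eventually
        (eventually_mem_tamePathsIn (stretchPath_stretchFactor_mem hp) hb1))] with q hq hq'
    have h2 := hq' (hq.1.1.stretchPath _)
    rw [stretchPath_stretchPath hb1.le h1, div_mul_cancel₀ _ h0.ne'] at h2
    exact (stretchFactor_le (h1.trans hb.le) h2).trans_lt hba

/-- A class of strict paths in the collar of a chain that is stable under stretching deforms into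
the paths subordinate to the chain. -/
theorem isDeformationRetract_of_stretch {S : Set C(I, X.Realization)}
    (h1 : c.strictTameIn ⊆ S) (h2 : S ⊆ c.strictInCollar)
    (h3 : ∀ p ∈ S, ∀ a, stretchPath a p ∈ S) : IsDeformationRetract c.strictTameIn S := by
  have hc : Continuous fun p : S => c.stretchFactor p :=
    continuousOn_iff_continuous_domRestrict.1 (continuousOn_stretchFactor.mono h2)
  have hr : ∀ p ∈ S, stretchPath (c.stretchFactor p) p ∈ c.strictTameIn := fun p hp =>
    ⟨stretchPath_stretchFactor_mem (h2 hp), stretchPath_mem_strictPaths (h2 hp).2 _⟩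
  -- The factor moves linearly from `1` to `c.stretchFactor p`, and is constantly `1` on
  -- `c.strictTameIn`.
  refine ⟨h1, ⟨fun p => ⟨_, hr p p.2⟩, ?_⟩, ⟨⟨⟨⟨fun q =>
    ⟨stretchPath (1 + q.1 * (c.stretchFactor q.2 - 1)) q.2, h3 _ q.2.2 _⟩, ?_⟩, ?_, ?_⟩, ?_⟩⟩⟩
  · exact (continuous_stretchPath.comp (hc.prodMk continuous_subtype_val)).subtype_mk _
  · refine (continuous_stretchPath.comp (Continuous.prodMk ?_ ?_)).subtype_mk _
    · exact continuous_const.add ((continuous_subtype_val.comp continuous_fst).mul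
        ((hc.comp continuous_snd).sub continuous_const))
    · exact continuous_subtype_val.comp continuous_snd
  · intro p
    refine Subtype.ext ?_
    simp [stretchPath_one]
  · intro p
    refine Subtype.ext ?_
    simp
  · intro s p hp
    refine Subtype.ext ?_
    simp [stretchFactor_eq_one (h2 p.2) hp.1, stretchPath_one]

end CubeChain

end PrecubicalSet

theorem mainTheorem6 (X : PrecubicalSet.{u}) (x y : X.cube 0)
    (c : PrecubicalSet.CubeChain X x y) :
    IsDeformationRetract c.strictTameIn c.strictInCollar ∧
      IsDeformationRetract c.strictTameIn c.strictTameInCollar :=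
  have h1 := c.strictTameIn_subset_strictTameInCollar
  have h2 := c.strictTameInCollar_subset_strictInCollar
  ⟨PrecubicalSet.CubeChain.isDeformationRetract_of_stretch (h1.trans h2) Subset.rfl
      fun _ hp a => PrecubicalSet.CubeChain.stretchPath_mem_strictInCollar hp a,
    PrecubicalSet.CubeChain.isDeformationRetract_of_stretch h1 h2
      fun _ hp a => PrecubicalSet.CubeChain.stretchPath_mem_strictTameInCollar hp a⟩
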